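/- Let $N\ge 1$ and $r=(r_1,\dots,r_N)$ with positive integers $r_k$. For $\alpha\in\mathbb Z^N$ let $(V_\alpha u)(x)=u(x-\alpha)$. The Wiener algebra $W(\mathbb Z^N)$ consists of all operators $A=\sum_{\alpha\in\mathbb Z^N}a_\alpha V_\alpha$ with $a_\alpha\in l^\infty(\mathbb Z^N)$ (complex-valued) and $\sum_\alpha\|a_\alpha\|_\infty<\infty$; each such $A$ acts boundedly on $l^p(\mathbb Z^N)$ for every $p\in[1,\infty]$. A function $a\in l^\infty(\mathbb Z^N)$ is slowly oscillating if $a(x+y)-a(x)\to0$ as $x\to\infty$ for every $y\in\mathbb Z^N$, and $r$-periodic if $a(x+r_ke_k)=a(x)$ for all $x\in\mathbb Z^N$ and all $k=1,\dots,N$, where $e_k$ is the $k$-th unit vector. Let $SP_r(\mathbb Z^N)$ be the smallest closed subalgebra of $l^\infty(\mathbb Z^N)$ that contains all slowly oscillating and all $r$-periodic functions, and let $W^{SP_r}(\mathbb Z^N)$ and $W^{P_r}(\mathbb Z^N)$ be the sets of all $A\in W(\mathbb Z^N)$ whose coefficients $a_\alpha$ all belong to $SP_r(\mathbb Z^N)$,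 respectively are all $r$-periodic. The essential spectrum $sp_{ess}(A|l^p)$ is the set of all $\lambda\in\mathbb C$ for which $A-\lambda I$ is not a Fredholm operator on $l^p(\mathbb Z^N)$. For $q\in(1,\infty)$, the operator spectrum $op(A|l^q)$ is the set of all limit operators of $A$ on $l^q(\mathbb Z^N)$, i.e. of all bounded operators $A_h$ on $l^q(\mathbb Z^N)$ for which there is a sequence $h:\mathbb N\to\mathbb Z^N$ tending to infinity such that $V_{-h(j)}AV_{h(j)}\to A_h$ strongly on $l^q(\mathbb Z^N)$ and $V_{-h(j)}A^*V_{h(j)}\to A_h^*$ strongly on the dual space. For $B=\sum_\alpha b_\alpha V_\alpha\in W^{P_r}(\mathbb Z^N)$ and $t\in\mathbb T^N$ ($\mathbb T$ the complex unit circle), let $\sigma(\mathcal B)(t)$ be the matrix $$\sigma(\mathcal B)(t)=\sum_{\alpha\in\mathbb Z^N}\mu(b_\alpha)\,\bigl(\hat\Lambda_1(t_1)^{-\alpha_1}\otimes\dots\otimes\hat\Lambda_N(t_N)^{-\alpha_N}\bigr)$$ acting on $\mathbb C^{r_1}\otimes\dots\otimes\mathbb C^{r_N}$, where $\mu(b)$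 is the diagonal matrix with entries $b(j_1,\dots,j_N)$, $0\le j_k<r_k$, and $\hat\Lambda_k(t_k)$ is the $r_k\times r_k$ matrix with ones on the first superdiagonal, $t_k^{-1}$ in the lower left corner and zeros elsewhere (the $1\times1$ matrix $(t_k^{-1})$ if $r_k=1$). **Proposition.** Let $A\in W^{SP_r}(\mathbb Z^N)$. Then the essential spectrum $sp_{ess}(A)$ of $A:l^p(\mathbb Z^N)\to l^p(\mathbb Z^N)$ does not depend on $p\in[1,\infty]$. Moreover, for every $q\in(1,\infty)$, all limit operators $A_h\in op(A|l^q)$ belong to $W^{P_r}(\mathbb Z^N)$ (so that their symbols $\sigma(\mathcal A_h)$ are defined), and $$sp_{ess}(A)=\bigcup_{A_h\in op(A|l^q)}\ \bigcup_{t\in\mathbb T^N}sp\,\bigl(\sigma(\mathcal A_h)(t)\bigr).$$ -/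

import Mathlib

open Filter Topology
open scoped ENNReal

noncomputable section

namespace SemiPeriodic

/-! ### Fredholm operators and the essential spectrum -/

/-- The essential spectrum of a bounded operator: all `z : ℂ` such that `A - z I` is not Fredholm. -/
def essSpectrum {X : Type*} [NormedAddCommGroup X] [NormedSpace ℂ X] (A : X →L[ℂ] X) : Set ℂ :=
  {z | ¬ (A - z • ContinuousLinearMap.id ℂ X).IsFredholm}

/-- On a Banach space, being Fredholm means that kernel and cokernel are finite dimensional. -/
theorem isFredholm_iff {X : Type*} [NormedAddCommGroup X] [NormedSpace ℂ X] [CompleteSpace X]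
    (A : X →L[ℂ] X) :
    A.IsFredholm ↔
      FiniteDimensional ℂ (LinearMap.ker (A : X →ₗ[ℂ] X)) ∧
        FiniteDimensional ℂ (X ⧸ LinearMap.range (A : X →ₗ[ℂ] X)) := by
  constructor
  · intro h
    exact ⟨h.finite_ker, h.finite_coker⟩
  · rintro ⟨h1, h2⟩
    have hK : (LinearMap.ker (A : X →ₗ[ℂ] X)).ClosedComplemented :=
      Submodule.ClosedComplemented.of_finiteDimensional _
    have hR : IsClosed ((LinearMap.range (A : X →ₗ[ℂ] X) : Submodule ℂ X) : Set X) := by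
      obtain ⟨E₁, hE₁, hc⟩ := hK.exists_isClosed_isCompl
      obtain ⟨F₀, hF₀⟩ := Submodule.exists_isCompl (LinearMap.range (A : X →ₗ[ℂ] X))
      have : FiniteDimensional ℂ F₀ :=
        LinearEquiv.finiteDimensional (Submodule.quotientEquivOfIsCompl _ _ hF₀)
      have : CompleteSpace E₁ := hE₁.completeSpace_coe
      have hr : LinearMap.range ((A ∘L E₁.subtypeL : E₁ →L[ℂ] X) : E₁ →ₗ[ℂ] X)
          = LinearMap.range (A : X →ₗ[ℂ] X) := by
        apply le_antisymm
        · rintro _ ⟨x, rfl⟩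
          exact ⟨x, rfl⟩
        · rintro _ ⟨x, rfl⟩
          obtain ⟨k, hk, e, he, rfl⟩ := Submodule.mem_sup.1
            (show x ∈ LinearMap.ker (A : X →ₗ[ℂ] X) ⊔ E₁ by rw [hc.sup_eq_top]; trivial)
          refine ⟨⟨e, he⟩, ?_⟩
          have hk' : A k = 0 := hk
          simp [hk']
      have hk : LinearMap.ker ((A ∘L E₁.subtypeL : E₁ →L[ℂ] X) : E₁ →ₗ[ℂ] X) = ⊥ := by
        rw [LinearMap.ker_eq_bot']
        rintro ⟨e, he⟩ h
        have : e ∈ LinearMap.ker (A : X →ₗ[ℂ] X) ⊓ E₁ := ⟨h, he⟩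
        rw [hc.inf_eq_bot] at this
        exact Subtype.ext this
      rw [← hr] at hF₀ ⊢
      exact ContinuousLinearMap.closed_complemented_range_of_isCompl_of_ker_eq_bot _ F₀ hF₀
        F₀.closed_of_finiteDimensional hk
    refine ⟨?_, hR, h1, h2, hK⟩
    have : CompleteSpace (LinearMap.range (A : X →ₗ[ℂ] X)) := hR.completeSpace_coe
    have ho := (A.codRestrict (LinearMap.range (A : X →ₗ[ℂ] X)) (fun x => ⟨x, rfl⟩)).isOpenMap
      (by rintro ⟨_, x, rfl⟩; exact ⟨x, rfl⟩)
    have hq := ho.isQuotientMap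
      ((A.codRestrict (LinearMap.range (A : X →ₗ[ℂ] X)) (fun x => ⟨x, rfl⟩)).continuous)
      (by rintro ⟨_, x, rfl⟩; exact ⟨x, rfl⟩)
    exact (Topology.isStrictMap_iff_isQuotientMap_rangeFactorization).2 hq

/-! ### The spaces `l^p(ℤ^N)`, shifts and multiplication operators -/

/-- The lattice `ℤ^N`. -/
abbrev Lat (N : ℕ) : Type := Fin N → ℤ

/-- The Banach space `l^p(ℤ^N)` of complex-valued functions. -/
abbrev Ell (N : ℕ) (p : ℝ≥0∞) : Type := lp (fun _ : Lat N => ℂ) p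

variable {N : ℕ}

theorem memℓp_shift {p : ℝ≥0∞} (α : Lat N) (u : Ell N p) :
    Memℓp (fun x => u (x - α) : Lat N → ℂ) p := by
  obtain (rfl | rfl | hp) := p.trichotomy
  · exact memℓp_zero
      ((lp.memℓp u).finite_dsupport.preimage (f := fun x => x - α) (sub_left_injective.injOn))
  · refine memℓp_infty ((lp.memℓp u).bddAbove.mono ?_)
    rintro _ ⟨x, rfl⟩
    exact ⟨x - α, rfl⟩
  · exact memℓp_gen (((lp.memℓp u).summable hp).comp_injective
      (i := fun x => x - α) sub_left_injective)

theorem norm_shift_le {p : ℝ≥0∞} [Fact (1 ≤ p)] (α : Lat N) (u : Ell N p) :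
    ‖(⟨fun x => u (x - α), memℓp_shift α u⟩ : Ell N p)‖ ≤ 1 * ‖u‖ := by
  have h0 : p ≠ 0 := (zero_lt_one.trans_le (Fact.out : (1 : ℝ≥0∞) ≤ p)).ne'
  rw [one_mul]
  obtain (rfl | rfl | hp) := p.trichotomy
  · exact absurd rfl h0
  · exact lp.norm_le_of_forall_le (norm_nonneg u)
      fun x => lp.norm_apply_le_norm h0 u (x - α)
  · refine lp.norm_le_of_tsum_le hp (norm_nonneg u) ?_
    rw [lp.norm_rpow_eq_tsum hp]
    exact ((Equiv.subRight α).tsum_eq (fun x => ‖u x‖ ^ p.toReal)).le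

/-- The shift `(V_α u)(x) = u(x - α)` on `l^p(ℤ^N)`. -/
def shift (p : ℝ≥0∞) [Fact (1 ≤ p)] (α : Lat N) : Ell N p →L[ℂ] Ell N p :=
  LinearMap.mkContinuous
    { toFun := fun u => ⟨fun x => u (x - α), memℓp_shift α u⟩
      map_add' := fun _ _ => rfl
      map_smul' := fun _ _ => rfl } 1 (norm_shift_le α)

@[simp] theorem shift_apply (p : ℝ≥0∞) [Fact (1 ≤ p)] (α : Lat N) (u : Ell N p) (x : Lat N) :
    shift p α u x = u (x - α) := rfl

theorem norm_mul_le_smul {p : ℝ≥0∞} (a : Ell N ∞) (u : Ell N p) (x : Lat N) :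
    ‖a x * u x‖ ≤ ‖(((‖a‖ : ℝ) : ℂ) • u) x‖ := by
  rw [lp.coeFn_smul, Pi.smul_apply, norm_smul, norm_mul, Complex.norm_real, norm_norm]
  exact mul_le_mul_of_nonneg_right (lp.norm_apply_le_norm ENNReal.top_ne_zero a x) (norm_nonneg _)

theorem memℓp_mul {p : ℝ≥0∞} (a : Ell N ∞) (u : Ell N p) :
    Memℓp (fun x => a x * u x : Lat N → ℂ) p :=
  (lp.memℓp (((‖a‖ : ℝ) : ℂ) • u)).mono' (norm_mul_le_smul a u)

theorem norm_mul_le {p : ℝ≥0∞} [Fact (1 ≤ p)] (a : Ell N ∞) (u : Ell N p) :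
    ‖(⟨fun x => a x * u x, memℓp_mul a u⟩ : Ell N p)‖ ≤ ‖a‖ * ‖u‖ := by
  have h0 : p ≠ 0 := (zero_lt_one.trans_le (Fact.out : (1 : ℝ≥0∞) ≤ p)).ne'
  refine (lp.norm_mono h0 (y := ((‖a‖ : ℝ) : ℂ) • u) (norm_mul_le_smul a u)).trans ?_
  rw [norm_smul, Complex.norm_real, norm_norm]

/-- The operator `aI` of multiplication by the bounded function `a` on `l^p(ℤ^N)`. -/
def mulOp (p : ℝ≥0∞) [Fact (1 ≤ p)] (a : Ell N ∞) : Ell N p →L[ℂ] Ell N p :=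
  LinearMap.mkContinuous
    { toFun := fun u => ⟨fun x => a x * u x, memℓp_mul a u⟩
      map_add' := fun u v => by
        ext x
        exact mul_add (a x) (u x) (v x)
      map_smul' := fun c u => by
        ext x
        exact mul_left_comm (a x) c (u x) } ‖a‖ (norm_mul_le a)

@[simp] theorem mulOp_apply (p : ℝ≥0∞) [Fact (1 ≤ p)] (a : Ell N ∞) (u : Ell N p) (x : Lat N) :
    mulOp p a u x = a x * u x := rfl

/-! ### The Wiener algebra -/

/-- An element `A = ∑_α a_α V_α` of the Wiener algebra `W(ℤ^N)`, given by its coefficients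
`a_α ∈ l^∞(ℤ^N)` with `∑_α ‖a_α‖_∞ < ∞`. -/
structure Wiener (N : ℕ) where
  /-- The coefficient functions `a_α`. -/
  coeff : Lat N → Ell N ∞
  summable_norm : Summable fun α => ‖coeff α‖

/-- The bounded operator `∑_α a_α V_α` on `l^p(ℤ^N)`; the series converges in operator norm. -/
def Wiener.toOp (A : Wiener N) (p : ℝ≥0∞) [Fact (1 ≤ p)] : Ell N p →L[ℂ] Ell N p :=
  ∑' α, mulOp p (A.coeff α) ∘L shift p α

theorem Wiener.summable_toOp (A : Wiener N) (p : ℝ≥0∞) [Fact (1 ≤ p)] :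
    Summable fun α => mulOp p (A.coeff α) ∘L shift p α := by
  refine Summable.of_norm_bounded A.summable_norm fun α => ?_
  refine (ContinuousLinearMap.opNorm_comp_le _ _).trans ?_
  have h1 : ‖mulOp p (A.coeff α)‖ ≤ ‖A.coeff α‖ :=
    LinearMap.mkContinuous_norm_le _ (norm_nonneg _) _
  have h2 : ‖shift p α‖ ≤ 1 := LinearMap.mkContinuous_norm_le _ zero_le_one _
  calc ‖mulOp p (A.coeff α)‖ * ‖shift p α‖ ≤ ‖A.coeff α‖ * 1 := by gcongr
    _ = ‖A.coeff α‖ := mul_one _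

/-- The operator acts by the formula `(A u)(x) = ∑_α a_α(x) u(x - α)`. -/
theorem Wiener.hasSum_toOp_apply (A : Wiener N) (p : ℝ≥0∞) [Fact (1 ≤ p)] (u : Ell N p)
    (x : Lat N) : HasSum (fun α => A.coeff α x * u (x - α)) (A.toOp p u x) := by
  have h1 : HasSum (fun α => mulOp p (A.coeff α) ∘L shift p α) (A.toOp p) :=
    (A.summable_toOp p).hasSum
  have h2 : HasSum (fun α => (mulOp p (A.coeff α) ∘L shift p α) u) (A.toOp p u) :=
    h1.mapL (ContinuousLinearMap.apply ℂ (Ell N p) u)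
  exact h2.mapL (lp.evalCLM ℂ (fun _ : Lat N => ℂ) p x)

/-! ### Limit operators -/

/-- `B` is the limit operator of `A` on `l^p(ℤ^N)` defined by the sequence `h`: the operators
`V_{-h(j)} A V_{h(j)}` converge strongly to `B`, and their Banach space adjoints
`f ↦ f ∘ (V_{-h(j)} A V_{h(j)})` converge strongly to the adjoint `f ↦ f ∘ B` of `B` on the dual
space of `l^p(ℤ^N)`. For `1 < p < ∞` this dual is `l^q(ℤ^N)` with `1/p + 1/q = 1`, and the adjoint
of `V_{-h(j)} A V_{h(j)}` is `V_{-h(j)} A^* V_{h(j)}` there. -/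
def IsLimitOp {p : ℝ≥0∞} [Fact (1 ≤ p)] (A : Ell N p →L[ℂ] Ell N p) (h : ℕ → Lat N)
    (B : Ell N p →L[ℂ] Ell N p) : Prop :=
  (∀ u : Ell N p,
    Tendsto (fun j => (shift p (-h j) ∘L A ∘L shift p (h j)) u) atTop (𝓝 (B u))) ∧
  (∀ f : Ell N p →L[ℂ] ℂ,
    Tendsto (fun j => f ∘L (shift p (-h j) ∘L A ∘L shift p (h j))) atTop (𝓝 (f ∘L B)))

/-- The operator spectrum `op(A)`: the set of all limit operators of `A` with respect to sequences
tending to infinity (that is, leaving every finite subset of `ℤ^N`). -/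
def opSpectrum {p : ℝ≥0∞} [Fact (1 ≤ p)] (A : Ell N p →L[ℂ] Ell N p) :
    Set (Ell N p →L[ℂ] Ell N p) :=
  {B | ∃ h : ℕ → Lat N, Tendsto h atTop cofinite ∧ IsLimitOp A h B}

/-! ### Slowly oscillating, periodic and semi-periodic functions -/

/-- The set `SO(ℤ^N)` of slowly oscillating functions. -/
def slowlyOscillating (N : ℕ) : Set (Ell N ∞) :=
  {a | ∀ y : Lat N, Tendsto (fun x : Lat N => a (x + y) - a x) cofinite (𝓝 0)}

/-- The set `P_r(ℤ^N)` of `r`-periodic functions, `r = (r_1, …, r_N)`: they have period `r_k` in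
the `k`-th coordinate direction for every `k`. -/
def periodic (r : Fin N → ℕ) : Set (Ell N ∞) :=
  {a | ∀ (k : Fin N) (x : Lat N), a (x + Pi.single k (r k : ℤ)) = a x}

/-- The algebra `SP_r(ℤ^N)` of semi-periodic functions: the smallest closed subalgebra of
`l^∞(ℤ^N)` that contains `SO(ℤ^N)` and `P_r(ℤ^N)`. (Constants belong to both sets.) -/
def semiPeriodic (r : Fin N → ℕ) : Subalgebra ℂ (Ell N ∞) :=
  (Algebra.adjoin ℂ (slowlyOscillating N ∪ periodic r)).topologicalClosure

/-- The class `W^{P_r}(ℤ^N)` of operators in the Wiener algebra with `r`-periodic coefficients. -/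
def wienerPeriodic (r : Fin N → ℕ) : Set (Wiener N) :=
  {A | ∀ α, A.coeff α ∈ periodic r}

/-- The class `W^{SP_r}(ℤ^N)` of operators in the Wiener algebra with coefficients in
`SP_r(ℤ^N)`. -/
def wienerSemiPeriodic (r : Fin N → ℕ) : Set (Wiener N) :=
  {A | ∀ α, A.coeff α ∈ semiPeriodic r}

/-! ### The matrix symbol of an operator with periodic coefficients -/

/-- The `n × n` matrix with ones on the first superdiagonal, `t⁻¹` in the lower left corner and
zeros elsewhere; for `n = 1` it is `(t⁻¹)`. -/
def lambdaHat (n : ℕ) (t : Circle) : Matrix (Fin n) (Fin n) ℂ :=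
  Matrix.of fun i j =>
    if (i : ℕ) + 1 = j then 1 else if (i : ℕ) + 1 = n ∧ (j : ℕ) = 0 then (t : ℂ)⁻¹ else 0

/-- The index set of the standard basis `e_{j_1} ⊗ … ⊗ e_{j_N}` of `ℂ^{r_1} ⊗ … ⊗ ℂ^{r_N}`, with
the indices `j_k` running from `0` to `r_k - 1`. -/
abbrev Cell (r : Fin N → ℕ) : Type := ∀ k : Fin N, Fin (r k)

/-- The matrix of the tensor product `M_1 ⊗ … ⊗ M_N` in the standard basis. -/
def tensorMatrix {r : Fin N → ℕ} (M : ∀ k, Matrix (Fin (r k)) (Fin (r k)) ℂ) :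
    Matrix (Cell r) (Cell r) ℂ :=
  Matrix.of fun i j => ∏ k, M k (i k) (j k)

/-- The diagonal matrix `μ(a)` of the values of `a` on the periodicity cell. -/
def cellDiag (r : Fin N → ℕ) (a : Ell N ∞) : Matrix (Cell r) (Cell r) ℂ :=
  Matrix.diagonal fun j => a fun k => ((j k : ℕ) : ℤ)

/-- The symbol `σ(𝒜)(t) = ∑_α μ(a_α) (Λ̂_1(t_1)^{-α_1} ⊗ … ⊗ Λ̂_N(t_N)^{-α_N})` at `t ∈ 𝕋^N`
of an operator `A = ∑_α a_α V_α` (with `r`-periodic coefficients). The series of matrices converges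
absolutely. -/
def Wiener.symbol (r : Fin N → ℕ) (A : Wiener N) (t : Fin N → Circle) :
    Matrix (Cell r) (Cell r) ℂ :=
  ∑' α : Lat N, cellDiag r (A.coeff α) * tensorMatrix fun k => lambdaHat (r k) (t k) ^ (-α k)

end SemiPeriodic

end

/-! Both inclusions pass through `CoeffLimit`, the pointwise convergence of the shifted coefficients
a_α(x + h(j)), in which no exponent occurs. For 1 < q < ∞ the limit operators on l^q are exactly the
operators given by such limits (`exists_coeffLimit_of_isLimitOp`, `CoeffLimit.isLimitOp`). The
limits are r-periodic because every function in SP_r has the asymptotic periods r_k e_k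
(`scale_mem_asymPeriods`).

If A - z is not Fredholm, z is an eigenvalue of some symbol: modulo the closure of the finite rank
operators, slowly oscillating multipliers commute with all shifts. Splitting ℤ^N into residue
classes mod r writes the class of A as ∑ x_ij E_ij, with matrix units E_ij and with x_ij in a
commutative Banach algebra, the bicommutant of the slowly oscillating multipliers and of the shifts
by multiples of r. Some character χ of this algebra annihilates det(x - z)
(`isUnit_sum_mul_matrixUnits`). On the shifts χ is a point t of the torus; on countably many slowly
oscillating functions it is the limit along a sequence tending to infinity
(`exists_seq_tendsto_character`). Hence χ(x) is the symbol at t of a limit operator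
(`exists_coeffLimit_symbol_eq`).

Conversely, an eigenvector of the symbol of a limit operator B extends to a bounded quasi-periodic
solution of Bu = zu. Damping it by exp(-ε|x|) gives approximate eigenvectors that are summable,
hence lie in every l^p (`exists_approximate_eigenvector`). Translated along h they form a singular
sequence for A - z, which a Fredholm operator cannot have (`CoeffLimit.mem_essSpectrum`). -/

noncomputable section

namespace SemiPeriodic

/-! ### The quotient of a normed ring by a closed two-sided ideal -/

section Quotient

variable {R : Type*} [NormedRing R] (I : Ideal R) [I.IsTwoSided] [IsClosed (I : Set R)]

/-- The quotient of a normed ring by a closed two-sided ideal is a normed ring. -/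
instance quotientNormedRing : NormedRing (R ⧸ I) :=
  { Submodule.Quotient.normedAddCommGroup I, Ideal.Quotient.ring I with
    norm_mul_le := fun x y => le_of_forall_pos_le_add fun ε hε => by
      have := ((Metric.nhds_basis_ball.prod_nhds Metric.nhds_basis_ball).tendsto_iff
        Metric.nhds_basis_ball).mp (continuous_mul.tendsto (‖x‖, ‖y‖)) ε hε
      simp only [Set.mem_prod, Metric.mem_ball, and_imp, Prod.forall, Prod.exists] at this
      rcases this with ⟨ε₁, ε₂, ⟨h₁, h₂⟩, h⟩
      obtain ⟨a, rfl, ha⟩ := Submodule.Quotient.norm_mk_lt (S := I) x h₁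
      obtain ⟨b, rfl, hb⟩ := Submodule.Quotient.norm_mk_lt (S := I) y h₂
      simp only [dist, abs_sub_lt_iff] at h
      specialize h ‖a‖ ‖b‖ ⟨by linarith, by linarith [Submodule.Quotient.norm_mk_le I a]⟩
        ⟨by linarith, by linarith [Submodule.Quotient.norm_mk_le I b]⟩
      calc
        _ ≤ ‖a‖ * ‖b‖ := (Submodule.Quotient.norm_mk_le I (a * b)).trans (_root_.norm_mul_le a b)
        _ ≤ _ := (sub_lt_iff_lt_add'.mp h.1).le }

instance quotientNormedAlgebra [NormedAlgebra ℂ R] : NormedAlgebra ℂ (R ⧸ I) :=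
  { (Ideal.Quotient.algebra ℂ : Algebra ℂ (R ⧸ I)) with
    norm_smul_le := (Submodule.Quotient.normedSpace I ℂ).norm_smul_le }

theorem norm_quotient_mk_le (a : R) : ‖Ideal.Quotient.mk I a‖ ≤ ‖a‖ :=
  Submodule.Quotient.norm_mk_le I a

instance [CompleteSpace R] : CompleteSpace (R ⧸ I) := Submodule.Quotient.completeSpace I

end Quotient

/-! ### The quotient by the closure of the finite rank operators -/

section Calkin

variable (X : Type*) [NormedAddCommGroup X] [NormedSpace ℂ X]

/-- The two-sided ideal of bounded operators of finite rank. -/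
def finiteRankIdeal : Ideal (X →L[ℂ] X) where
  carrier := {F | (F : X →ₗ[ℂ] X).HasNoetherianRange}
  add_mem' := fun ha hb => ha.add hb
  zero_mem' := by simp
  smul_mem' := fun c x hx => LinearMap.HasNoetherianRange.comp_left hx (c : X →ₗ[ℂ] X)

instance : (finiteRankIdeal X).IsTwoSided :=
  ⟨fun {a} b ha => LinearMap.HasNoetherianRange.comp_right
    (v := (a : X →ₗ[ℂ] X)) ha (b : X →ₗ[ℂ] X)⟩

/-- The closed two-sided ideal of norm limits of operators of finite rank. -/
def approximableIdeal : Ideal (X →L[ℂ] X) := (finiteRankIdeal X).closure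

instance : IsClosed (approximableIdeal X : Set (X →L[ℂ] X)) := isClosed_closure

instance : (approximableIdeal X).IsTwoSided :=
  ⟨fun b ha => map_mem_closure (f := fun x => x * b) (continuous_mul_const b) ha
    fun _ hx => (finiteRankIdeal X).mul_mem_right b hx⟩

/-- The algebra of bounded operators modulo norm limits of operators of finite rank. -/
def Calkin : Type _ := (X →L[ℂ] X) ⧸ approximableIdeal X

instance : NormedRing (Calkin X) := quotientNormedRing (approximableIdeal X)

instance : NormedAlgebra ℂ (Calkin X) := quotientNormedAlgebra (approximableIdeal X)

instance [CompleteSpace X] : CompleteSpace (Calkin X) :=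
  inferInstanceAs (CompleteSpace ((X →L[ℂ] X) ⧸ approximableIdeal X))

variable {X}

/-- The class of an operator modulo norm limits of operators of finite rank. -/
def toCalkin : (X →L[ℂ] X) →ₐ[ℂ] Calkin X := Ideal.Quotient.mkₐ ℂ (approximableIdeal X)

theorem toCalkin_surjective : Function.Surjective (toCalkin (X := X)) :=
  Ideal.Quotient.mkₐ_surjective ℂ (approximableIdeal X)

theorem norm_toCalkin_le (T : X →L[ℂ] X) : ‖toCalkin T‖ ≤ ‖T‖ :=
  norm_quotient_mk_le _ T

theorem continuous_toCalkin : Continuous (toCalkin (X := X)) :=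
  AddMonoidHomClass.continuous_of_bound (toCalkin (X := X)) 1
    fun T => by rw [one_mul]; exact norm_toCalkin_le T

theorem toCalkin_eq_zero {T : X →L[ℂ] X} : toCalkin T = 0 ↔ T ∈ approximableIdeal X :=
  Ideal.Quotient.eq_zero_iff_mem

theorem toCalkin_eq_one {T : X →L[ℂ] X} : toCalkin T = 1 ↔ T - 1 ∈ approximableIdeal X := by
  rw [← toCalkin_eq_zero, map_sub, map_one, sub_eq_zero]

/-- An operator which is the identity up to a norm limit of finite rank operators
is invertible up to a finite rank operator. -/
theorem exists_unit_of_sub_one_mem [CompleteSpace X] {T : X →L[ℂ] X}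
    (hT : T - 1 ∈ approximableIdeal X) :
    ∃ U : (X →L[ℂ] X)ˣ, T - U ∈ finiteRankIdeal X := by
  -- With F of finite rank at distance less than 1 from T - 1, the operator T - F is invertible by
  -- the Neumann series.
  obtain ⟨F, hF, hd⟩ := Metric.mem_closure_iff.1 hT 1 one_pos
  rw [dist_eq_norm] at hd
  have hu : ‖-(T - 1 - F)‖ < 1 := by rwa [norm_neg]
  refine ⟨Units.oneSub _ hu, ?_⟩
  have : T - (Units.oneSub _ hu : (X →L[ℂ] X)ˣ) = F := by
    rw [Units.val_oneSub]; abel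
  rw [this]
  exact hF

theorem isFredholm_of_mem_finiteRankIdeal {T R : X →L[ℂ] X} (h1 : T * R - 1 ∈ finiteRankIdeal X)
    (h2 : R * T - 1 ∈ finiteRankIdeal X) : T.IsFredholm :=
  ContinuousLinearMap.IsFredholm.of_isQuasiInverse (v := R)
    ⟨LinearMap.FiniteRangeSetoid.equiv_iff_hasNoetherianRange.2 h2,
      LinearMap.FiniteRangeSetoid.equiv_iff_hasNoetherianRange.2 h1⟩

/-- An inverse modulo the closure improves to one modulo the finite rank ideal itself: TR and RT
differ by finite rank from invertible operators U and W, so R U⁻¹ is a right and W⁻¹ R a left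
inverse modulo finite rank, and the two agree there. -/
theorem isFredholm_of_isUnit_toCalkin [CompleteSpace X] {T : X →L[ℂ] X}
    (hT : IsUnit (toCalkin T)) : T.IsFredholm := by
  obtain ⟨u, hu⟩ := hT
  obtain ⟨R, hR⟩ := toCalkin_surjective (↑u⁻¹ : Calkin X)
  have hTR : T * R - 1 ∈ approximableIdeal X := by
    rw [← toCalkin_eq_one, map_mul]
    rw [hR, ← hu, Units.mul_inv]
  have hRT : R * T - 1 ∈ approximableIdeal X := by
    rw [← toCalkin_eq_one, map_mul]
    rw [hR, ← hu, Units.inv_mul]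
  obtain ⟨U, hU⟩ := exists_unit_of_sub_one_mem hTR
  obtain ⟨W, hW⟩ := exists_unit_of_sub_one_mem hRT
  set J := finiteRankIdeal X
  let m := Ideal.Quotient.mk J
  have e1 : m T * m (R * ↑U⁻¹) = 1 := by
    rw [← map_mul, ← map_one m, Ideal.Quotient.eq]
    have := J.mul_mem_right (↑U⁻¹ : X →L[ℂ] X) hU
    rwa [sub_mul, Units.mul_inv, mul_assoc] at this
  have e2 : m (↑W⁻¹ * R) * m T = 1 := by
    rw [← map_mul, ← map_one m, Ideal.Quotient.eq]
    have := J.mul_mem_left (↑W⁻¹ : X →L[ℂ] X) hW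
    rwa [mul_sub, Units.inv_mul, ← mul_assoc] at this
  have e3 : m (R * ↑U⁻¹) * m T = 1 := by
    rw [← left_inv_eq_right_inv e2 e1, e2]
  rw [← map_mul, ← map_one m, Ideal.Quotient.eq] at e1 e3
  exact isFredholm_of_mem_finiteRankIdeal e1 e3

/-- A Fredholm operator has no singular sequence converging weakly to zero in the sense that
a separating family of continuous functionals tends to zero along it. -/
theorem not_isFredholm_of_singular_sequence {ι : Type*} {T : X →L[ℂ] X} (e : ι → X →L[ℂ] ℂ)
    (he : ∀ x, (∀ i, e i x = 0) → x = 0) (u : ℕ → X) (hu : ∀ n, ‖u n‖ = 1)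
    (hue : ∀ i, Tendsto (fun n => e i (u n)) atTop (𝓝 0))
    (hTu : Tendsto (fun n => T (u n)) atTop (𝓝 0)) : ¬ T.IsFredholm := by
  intro hT
  obtain ⟨R, hR, -⟩ := hT.exists_isQuasiInverse
  have hP : ((R * T - 1 : X →L[ℂ] X) : X →ₗ[ℂ] X).HasNoetherianRange :=
    LinearMap.FiniteRangeSetoid.equiv_iff_hasNoetherianRange.1 hR
  set P : X →L[ℂ] X := R * T - 1 with hPdef
  have hfin : IsNoetherian ℂ (P : X →ₗ[ℂ] X).range := hP
  have hfd : FiniteDimensional ℂ (P : X →ₗ[ℂ] X).range := inferInstance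
  have : ProperSpace (P : X →ₗ[ℂ] X).range := FiniteDimensional.proper ℂ _
  -- The bounded sequence P uₙ lives in a finite dimensional space, so a subsequence converges; then
  -- u = RTu - Pu converges in norm along it.
  let y : ℕ → (P : X →ₗ[ℂ] X).range := fun n => ⟨P (u n), u n, rfl⟩
  have hy : ∀ n, y n ∈ Metric.closedBall (0 : (P : X →ₗ[ℂ] X).range) ‖P‖ := by
    intro n
    rw [mem_closedBall_zero_iff]
    have := P.le_opNorm (u n)
    rwa [hu, mul_one] at this
  obtain ⟨z, -, φ, hφ, hz⟩ :=
    (isCompact_closedBall (0 : (P : X →ₗ[ℂ] X).range) ‖P‖).tendsto_subseq hy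
  have hz' : Tendsto (fun n => P (u (φ n))) atTop (𝓝 (z : X)) :=
    (continuous_subtype_val.tendsto z).comp hz
  have h1 : Tendsto (fun n => R (T (u (φ n)))) atTop (𝓝 0) := by
    have := (R.continuous.tendsto 0).comp (hTu.comp hφ.tendsto_atTop)
    rwa [map_zero] at this
  have h2 : Tendsto (fun n => u (φ n)) atTop (𝓝 (-(z : X))) := by
    have := h1.sub hz'
    rw [zero_sub] at this
    refine this.congr fun n => ?_
    simp [hPdef]
  -- All functionals of the separating family vanish at the limit, yet the limit must have norm 1.
  have h3 : -(z : X) = 0 := by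
    refine he _ fun i => ?_
    exact tendsto_nhds_unique (((e i).continuous.tendsto _).comp h2)
      ((hue i).comp hφ.tendsto_atTop)
  rw [h3] at h2
  have := h2.norm
  simp [hu] at this

end Calkin

/-! ### Matrices over a commutative subalgebra of a Banach algebra -/

section MatrixUnits

variable {D : Type*} [NormedRing D] [NormedAlgebra ℂ D]

/-- The bicommutant of a subset of an algebra. -/
abbrev bicommutant (S : Set D) : Subalgebra ℂ D := Subalgebra.centralizer ℂ S.centralizer

theorem subset_bicommutant (S : Set D) : S ⊆ bicommutant S := Set.subset_centralizer_centralizer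

theorem isClosed_bicommutant (S : Set D) : IsClosed (bicommutant S : Set D) :=
  Set.isClosed_centralizer _

/-- Let `x i j` belong to the bicommutant of a commuting set `S` and let `E i j` be matrix units
commuting with `S`. If no character of the bicommutant annihilates the determinant of `x`, then
`∑ x i j * E i j` is invertible. -/
theorem isUnit_sum_mul_matrixUnits [CompleteSpace D] {ι : Type*} [Fintype ι] [DecidableEq ι]
    {S : Set D}
    (hS : ∀ a ∈ S, ∀ b ∈ S, a * b = b * a) (E : ι → ι → D)
    (hE : ∀ i j k l, E i j * E k l = if j = k then E i l else 0) (hE1 : ∑ i, E i i = 1)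
    (hES : ∀ i j, ∀ s ∈ S, E i j * s = s * E i j) (x : Matrix ι ι (bicommutant S))
    (hx : ∀ χ : bicommutant S →ₐ[ℂ] ℂ, Continuous χ → (∀ y, ‖χ y‖ ≤ ‖y‖ * ‖(1 : D)‖) →
      (x.map χ).det ≠ 0) :
    IsUnit (∑ i, ∑ j, (x i j : D) * E i j) := by
  let _ : NormedCommRing (bicommutant S) :=
    { (inferInstance : NormedRing (bicommutant S)) with
      mul_comm := fun a b => Subtype.ext
        (Set.centralizer_centralizer_comm_of_comm hS a a.2 b b.2) }
  have : CompleteSpace (bicommutant S) := (isClosed_bicommutant S).completeSpace_coe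
  have hdet : IsUnit x.det := by
    by_contra h
    obtain ⟨χ, hχ⟩ := WeakDual.CharacterSpace.exists_apply_eq_zero h
    -- A non-unit of a commutative complex Banach algebra is annihilated by some character, and
    -- characters commute with determinants.
    refine hx (WeakDual.CharacterSpace.toAlgHom χ) (map_continuous χ) (fun y => ?_) ?_
    · exact AlgHom.norm_apply_le_self_mul_norm_one _ y
    · rw [← hχ]
      exact (AlgHom.map_det (WeakDual.CharacterSpace.toAlgHom χ) x).symm
  -- Φ is multiplicative and unital, so it carries the inverse matrix of `x` to an inverse in `D`.
  let Φ : Matrix ι ι (bicommutant S) → D := fun M => ∑ i, ∑ j, (M i j : D) * E i j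
  -- The matrix units lie in the centralizer of `S`, hence commute with the whole bicommutant.
  have hcomm : ∀ (a : bicommutant S) i j, E i j * (a : D) = a * E i j := fun a i j =>
    a.2 (E i j) (fun s hs => (hES i j s hs).symm)
  have hmul : ∀ M N, Φ M * Φ N = Φ (M * N) := by
    intro M N
    have key : ∀ i j k l, ((M i j : D) * E i j) * ((N k l : D) * E k l)
        = if j = k then ((M i j : D) * (N k l : D)) * E i l else 0 := by
      intro i j k l
      rw [mul_assoc, ← mul_assoc (E i j), hcomm, mul_assoc (N k l : D), hE]
      split_ifs
      · rw [mul_assoc]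
      · simp
    simp only [Φ, Finset.sum_mul, Finset.mul_sum, key, Matrix.mul_apply]
    simp only [Finset.sum_ite_eq', Finset.mem_univ, if_true, AddSubmonoidClass.coe_finsetSum,
      MulMemClass.coe_mul, Finset.sum_mul]
    rw [Finset.sum_congr rfl fun k _ => Finset.sum_comm, Finset.sum_comm]
    exact Finset.sum_congr rfl fun i _ => Finset.sum_comm
  have hone : Φ 1 = 1 := by
    simp only [Φ, Matrix.one_apply]
    rw [← hE1]
    refine Finset.sum_congr rfl fun i _ => ?_
    rw [Finset.sum_eq_single i]
    · simp
    · intro j _ hj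
      simp [hj.symm]
    · simp
  obtain ⟨N, hN⟩ := (Matrix.isUnit_iff_isUnit_det x).2 hdet |>.exists_right_inv
  obtain ⟨N', hN'⟩ := (Matrix.isUnit_iff_isUnit_det x).2 hdet |>.exists_left_inv
  exact isUnit_iff_exists_and_exists.2
    ⟨⟨Φ N, by rw [← hone, ← hN]; exact hmul x N⟩, ⟨Φ N', by rw [← hone, ← hN']; exact hmul N' x⟩⟩

end MatrixUnits

variable {N : ℕ}

/-! ### Operators of the Wiener algebra on `l^p` -/

theorem exponent_ne_zero (p : ℝ≥0∞) [h : Fact (1 ≤ p)] : p ≠ 0 :=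
  (zero_lt_one.trans_le h.out).ne'

theorem norm_mulOp_le (p : ℝ≥0∞) [Fact (1 ≤ p)] (a : Ell N ∞) : ‖mulOp p a‖ ≤ ‖a‖ :=
  LinearMap.mkContinuous_norm_le _ (norm_nonneg _) _

theorem norm_shiftOp_le (p : ℝ≥0∞) [Fact (1 ≤ p)] (α : Lat N) : ‖shift p α‖ ≤ 1 :=
  LinearMap.mkContinuous_norm_le _ zero_le_one _

theorem norm_mulOp_comp_shift_le (p : ℝ≥0∞) [Fact (1 ≤ p)] (a : Ell N ∞) (α : Lat N) :
    ‖mulOp p a ∘L shift p α‖ ≤ ‖a‖ := by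
  refine (ContinuousLinearMap.opNorm_comp_le _ _).trans ?_
  calc ‖mulOp p a‖ * ‖shift p α‖ ≤ ‖a‖ * 1 :=
        mul_le_mul (norm_mulOp_le p a) (norm_shiftOp_le p α) (norm_nonneg _) (norm_nonneg _)
    _ = ‖a‖ := mul_one _

theorem norm_shift_apply (p : ℝ≥0∞) [Fact (1 ≤ p)] (α : Lat N) (u : Ell N p) :
    ‖shift p α u‖ = ‖u‖ := by
  refine le_antisymm ((norm_shift_le α u).trans_eq (one_mul _)) ?_
  have h : shift p (-α) (shift p α u) = u := by
    ext x
    simp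
  calc ‖u‖ = ‖shift p (-α) (shift p α u)‖ := by rw [h]
    _ ≤ ‖shift p α u‖ := (norm_shift_le (-α) (shift p α u)).trans_eq (one_mul _)

theorem Wiener.norm_toOp_le (A : Wiener N) (p : ℝ≥0∞) [Fact (1 ≤ p)] :
    ‖A.toOp p‖ ≤ ∑' α, ‖A.coeff α‖ :=
  tsum_of_norm_bounded A.summable_norm.hasSum fun α => norm_mulOp_comp_shift_le p _ α

/-- The difference of two elements of the Wiener algebra. -/
def Wiener.diff (A B : Wiener N) : Wiener N where
  coeff α := A.coeff α - B.coeff α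
  summable_norm := Summable.of_nonneg_of_le (fun _ => norm_nonneg _) (fun _ => norm_sub_le _ _)
    (A.summable_norm.add B.summable_norm)

theorem Wiener.toOp_diff (A B : Wiener N) (p : ℝ≥0∞) [Fact (1 ≤ p)] :
    (A.diff B).toOp p = A.toOp p - B.toOp p := by
  refine ContinuousLinearMap.ext fun u => lp.ext (funext fun x => ?_)
  refine ((A.diff B).hasSum_toOp_apply p u x).unique ?_
  have := (A.hasSum_toOp_apply p u x).sub (B.hasSum_toOp_apply p u x)
  refine this.congr_fun ?_
  intro α
  simp [Wiener.diff, sub_mul]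

/-- The operator `V_{-h} A V_h` as an element of the Wiener algebra. -/
def Wiener.translate (A : Wiener N) (h : Lat N) : Wiener N where
  coeff α := shift ∞ (-h) (A.coeff α)
  summable_norm := by simpa only [norm_shift_apply] using A.summable_norm

@[simp] theorem Wiener.translate_coeff_apply (A : Wiener N) (h α x : Lat N) :
    (A.translate h).coeff α x = A.coeff α (x + h) := by
  simp [Wiener.translate]

theorem Wiener.norm_translate_coeff (A : Wiener N) (h α : Lat N) :
    ‖(A.translate h).coeff α‖ = ‖A.coeff α‖ := norm_shift_apply _ _ _

theorem Wiener.toOp_translate (A : Wiener N) (h : Lat N) (p : ℝ≥0∞) [Fact (1 ≤ p)] :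
    (A.translate h).toOp p = shift p (-h) ∘L A.toOp p ∘L shift p h := by
  refine ContinuousLinearMap.ext fun u => lp.ext (funext fun x => ?_)
  refine ((A.translate h).hasSum_toOp_apply p u x).unique ?_
  have := A.hasSum_toOp_apply p (shift p h u) (x + h)
  simp only [ContinuousLinearMap.comp_apply, shift_apply, sub_neg_eq_add,
    Wiener.translate_coeff_apply] at this ⊢
  refine this.congr_fun ?_
  intro α
  rw [add_sub_right_comm, add_sub_cancel_right]

theorem mulOp_shift_single (p : ℝ≥0∞) [Fact (1 ≤ p)] (a : Ell N ∞) (α y : Lat N) (c : ℂ) :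
    (mulOp p a ∘L shift p α) (lp.single p y c) = lp.single p (y + α) (a (y + α) * c) := by
  ext x
  by_cases h : x = y + α
  · subst h
    simp
  · have h' : x - α ≠ y := fun e => h (by rw [← e]; abel)
    simp [h, h']

theorem Wiener.toOp_single_apply (A : Wiener N) (p : ℝ≥0∞) [Fact (1 ≤ p)] (y x : Lat N) (c : ℂ) :
    A.toOp p (lp.single p y c) x = A.coeff (x - y) x * c := by
  refine (A.hasSum_toOp_apply p (lp.single p y c) x).unique ?_
  have : A.coeff (x - y) x * c
      = A.coeff (x - y) x * (lp.single p y c : Ell N p) (x - (x - y)) := by simp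
  rw [this]
  refine hasSum_single _ fun α hα => ?_
  have h' : x - α ≠ y := fun e => hα (by rw [← e]; abel)
  simp [h']

/-- Each term of the series sends a delta function to a delta function, whose norm does not depend
on p. The resulting column sum is suited to dominated convergence. -/
theorem Wiener.norm_toOp_single_le (A : Wiener N) (p : ℝ≥0∞) [Fact (1 ≤ p)] (y : Lat N) (c : ℂ) :
    ‖A.toOp p (lp.single p y c)‖ ≤ ∑' α, ‖A.coeff α (y + α) * c‖ := by
  have hs : Summable fun α => ‖A.coeff α (y + α) * c‖ := by
    refine Summable.of_nonneg_of_le (fun _ => norm_nonneg _) (fun α => ?_)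
      (A.summable_norm.mul_right ‖c‖)
    rw [norm_mul]
    exact mul_le_mul_of_nonneg_right (lp.norm_apply_le_norm ENNReal.top_ne_zero _ _)
      (norm_nonneg _)
  have h := (A.summable_toOp p).hasSum.mapL
    (ContinuousLinearMap.apply ℂ (Ell N p) (lp.single p y c : Ell N p))
  have h' : A.toOp p (lp.single p y c)
      = ∑' α, lp.single p (y + α) (A.coeff α (y + α) * c) := by
    exact h.tsum_eq.symm.trans (tsum_congr fun α => mulOp_shift_single p _ α y c)
  rw [h']
  have hn : ∀ α, ‖(lp.single p (y + α) (A.coeff α (y + α) * c) : Ell N p)‖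
      = ‖A.coeff α (y + α) * c‖ := fun α =>
    lp.norm_single (pos_iff_ne_zero.2 (exponent_ne_zero p)) _ _
  refine (norm_tsum_le_tsum_norm ?_).trans (le_of_eq (tsum_congr hn))
  simpa only [hn] using hs

/-! ### Convergence of the coefficients -/

/-- The ε/2 argument for equibounded operators; it serves on l^p itself and, for the adjoints, on
the dual space. -/
theorem tendsto_zero_of_tendsto {X Y κ : Type*} [NormedAddCommGroup X] [NormedSpace ℂ X]
    [NormedAddCommGroup Y] [NormedSpace ℂ Y] {l : Filter κ} [l.NeBot] (T : ℕ → X →L[ℂ] Y) {C : ℝ}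
    (hC : ∀ j, ‖T j‖ ≤ C) {v : κ → X} {u : X} (hv : Tendsto v l (𝓝 u))
    (h : ∀ k, Tendsto (fun j => T j (v k)) atTop (𝓝 0)) :
    Tendsto (fun j => T j u) atTop (𝓝 0) := by
  have hC0 : 0 ≤ C := (norm_nonneg _).trans (hC 0)
  rw [Metric.tendsto_atTop]
  intro ε hε
  -- C + 1 in place of C keeps the denominator positive when C = 0.
  obtain ⟨k, hk⟩ := ((Metric.tendsto_nhds.1 hv) (ε / (2 * (C + 1))) (by positivity)).exists
  obtain ⟨n, hn⟩ := (Metric.tendsto_atTop.1 (h k)) (ε / 2) (half_pos hε)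
  refine ⟨n, fun j hj => ?_⟩
  have h1 := hn j hj
  rw [dist_zero_right] at h1 ⊢
  rw [dist_comm, dist_eq_norm] at hk
  have h2 : ‖T j (u - v k)‖ ≤ ε / 2 := by
    calc ‖T j (u - v k)‖ ≤ C * (ε / (2 * (C + 1))) := by
          refine ((T j).le_opNorm _).trans ?_
          gcongr
          exact hC j
      _ ≤ (C + 1) * (ε / (2 * (C + 1))) := by gcongr; linarith
      _ = ε / 2 := by field_simp
  calc ‖T j u‖ = ‖T j (u - v k) + T j (v k)‖ := by rw [← map_add, sub_add_cancel]
    _ ≤ ‖T j (u - v k)‖ + ‖T j (v k)‖ := norm_add_le _ _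
    _ < ε := by linarith

section Convergence

variable {C : ℕ → Wiener N} {g : Lat N → ℝ}

/-- Reduces to delta functions, where the column sums tend to zero by dominated convergence.
Assuming `hu` instead of p < ∞ lets this apply to summable functions in l^∞. -/
theorem tendsto_toOp_apply (p : ℝ≥0∞) [Fact (1 ≤ p)] (hg : Summable g)
    (hC : ∀ j α, ‖(C j).coeff α‖ ≤ g α)
    (h0 : ∀ α x, Tendsto (fun j => (C j).coeff α x) atTop (𝓝 0)) (u : Ell N p)
    (hu : HasSum (fun x => (lp.single p x (u x) : Ell N p)) u) :
    Tendsto (fun j => (C j).toOp p u) atTop (𝓝 0) := by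
  refine tendsto_zero_of_tendsto (C := ∑' α, g α) (fun j => (C j).toOp p) (fun j => ?_) hu
    fun s => ?_
  · exact ((C j).norm_toOp_le p).trans ((C j).summable_norm.tsum_le_tsum (hC j) hg)
  · simp only [map_sum]
    rw [← Finset.sum_const_zero (s := s)]
    refine tendsto_finsetSum _ fun y _ => ?_
    rw [tendsto_zero_iff_norm_tendsto_zero]
    refine squeeze_zero (fun _ => norm_nonneg _)
      (fun j => (C j).norm_toOp_single_le p y (u y)) ?_
    rw [← tsum_zero (α := ℝ) (β := Lat N)]
    refine tendsto_tsum_of_dominated_convergence (hg.mul_right ‖u y‖) (fun α => ?_)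
      (Eventually.of_forall fun j α => ?_)
    · have := ((h0 α (y + α)).mul_const (u y)).norm
      simpa using this
    · rw [norm_norm, norm_mul]
      exact mul_le_mul_of_nonneg_right
        ((lp.norm_apply_le_norm ENNReal.top_ne_zero _ _).trans (hC j α)) (norm_nonneg _)

/-- The norm of the functional is at most the row sum ∑ |a_α(x)|, which is dominated by `g`. -/
theorem tendsto_eval_comp_toOp (p : ℝ≥0∞) [Fact (1 ≤ p)] (hg : Summable g)
    (hC : ∀ j α, ‖(C j).coeff α‖ ≤ g α)
    (h0 : ∀ α x, Tendsto (fun j => (C j).coeff α x) atTop (𝓝 0)) (x : Lat N) :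
    Tendsto (fun j => lp.evalCLM ℂ (fun _ : Lat N => ℂ) p x ∘L (C j).toOp p) atTop (𝓝 0) := by
  rw [tendsto_zero_iff_norm_tendsto_zero]
  have hs : ∀ j, Summable fun α => ‖(C j).coeff α x‖ := fun j =>
    Summable.of_nonneg_of_le (fun _ => norm_nonneg _)
      (fun α => lp.norm_apply_le_norm ENNReal.top_ne_zero _ _) (C j).summable_norm
  refine squeeze_zero (fun _ => norm_nonneg _) (g := fun j => ∑' α, ‖(C j).coeff α x‖)
    (fun j => ?_) ?_
  · refine ContinuousLinearMap.opNorm_le_bound _ (tsum_nonneg fun _ => norm_nonneg _) fun u => ?_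
    change ‖(C j).toOp p u x‖ ≤ _
    rw [← ((C j).hasSum_toOp_apply p u x).tsum_eq, ← tsum_mul_right]
    refine tsum_of_norm_bounded ((hs j).mul_right ‖u‖).hasSum fun α => ?_
    rw [norm_mul]
    exact mul_le_mul_of_nonneg_left (lp.norm_apply_le_norm (exponent_ne_zero p) _ _)
      (norm_nonneg _)
  · rw [← tsum_zero (α := ℝ) (β := Lat N)]
    refine tendsto_tsum_of_dominated_convergence hg (fun α => ?_)
      (Eventually.of_forall fun j α => ?_)
    · simpa using (h0 α x).norm
    · rw [norm_norm]
      exact (lp.norm_apply_le_norm ENNReal.top_ne_zero _ _).trans (hC j α)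

end Convergence

/-! ### Functionals on `l^q` for `1 < q < ∞` -/

section Dual

variable {q : ℝ≥0∞} [Fact (1 ≤ q)]

omit [Fact (1 ≤ q)] in
theorem norm_add_rpow_le_of_disjoint (hq : 0 < q.toReal) (u v : Ell N q)
    (h : ∀ x, u x = 0 ∨ v x = 0) :
    ‖u + v‖ ^ q.toReal ≤ ‖u‖ ^ q.toReal + ‖v‖ ^ q.toReal := by
  rw [lp.norm_rpow_eq_tsum hq, lp.norm_rpow_eq_tsum hq, lp.norm_rpow_eq_tsum hq,
    ← ((lp.memℓp u).summable hq).tsum_add ((lp.memℓp v).summable hq)]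
  refine le_of_eq (tsum_congr fun x => ?_)
  rcases h x with h | h <;> simp [h, Real.zero_rpow hq.ne']

/-- The projection onto the functions supported in a finite set. -/
def finProj (q : ℝ≥0∞) [Fact (1 ≤ q)] (s : Finset (Lat N)) : Ell N q →L[ℂ] Ell N q :=
  ∑ x ∈ s, (lp.singleContinuousLinearMap ℂ (fun _ : Lat N => ℂ) q x) ∘L
    lp.evalCLM ℂ (fun _ : Lat N => ℂ) q x

theorem finProj_eq (s : Finset (Lat N)) (u : Ell N q) :
    finProj q s u = ∑ x ∈ s, (lp.single q x (u x) : Ell N q) := by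
  simp only [finProj, _root_.sum_apply]
  rfl

theorem finProj_apply (s : Finset (Lat N)) (u : Ell N q) (x : Lat N) :
    finProj q s u x = if x ∈ s then u x else 0 := by
  rw [finProj_eq, lp.coeFn_sum, Finset.sum_apply]
  simp only [lp.coeFn_single, Pi.single_apply]
  rw [Finset.sum_ite_eq]

theorem tendsto_finProj (hq : q ≠ ∞) (u : Ell N q) :
    Tendsto (fun s => finProj q s u) atTop (𝓝 u) := by
  have := lp.hasSum_single hq u
  simp only [finProj_eq]
  exact this

theorem exists_phase (z w : ℂ) : ∃ c : ℂ, ‖c‖ ≤ 1 ∧ ‖z + c * w‖ = ‖z‖ + ‖w‖ := by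
  rcases eq_or_ne w 0 with rfl | hw
  · exact ⟨0, by simp, by simp⟩
  rcases eq_or_ne z 0 with rfl | hz
  · exact ⟨1, by simp, by simp⟩
  have hw' := norm_pos_iff.2 hw
  have hz' := norm_pos_iff.2 hz
  refine ⟨z / ‖z‖ * (‖w‖ / w), ?_, ?_⟩
  · simp [hw'.ne', hz'.ne']
  · have hzc : (‖z‖ : ℂ) ≠ 0 := by exact_mod_cast hz'.ne'
    have : z + z / ‖z‖ * (‖w‖ / w) * w = z / ‖z‖ * ((‖z‖ + ‖w‖ : ℝ) : ℂ) := by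
      push_cast
      field_simp
    rw [this, norm_mul, norm_div, Complex.norm_real, norm_norm, div_self hz'.ne', one_mul,
      Complex.norm_real, Real.norm_of_nonneg (by positivity)]

/-- The norm of a functional on `l^q`, `1 < q < ∞`, is small on functions supported far away. -/
theorem exists_finset_functional_le (hq1 : 1 < q) (hq : q ≠ ∞) (f : Ell N q →L[ℂ] ℂ) {ε : ℝ}
    (hε : 0 < ε) :
    ∃ s : Finset (Lat N), ∀ v : Ell N q, (∀ x ∈ s, v x = 0) → ‖f v‖ ≤ ε * ‖v‖ := by
  have hr1 : 1 < q.toReal := by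
    rw [← ENNReal.toReal_one]
    exact (ENNReal.toReal_lt_toReal ENNReal.one_ne_top hq).2 hq1
  have hr0 : 0 < q.toReal := by linarith
  set r := q.toReal
  -- If f almost attains its norm at u, adding τv with v supported off u raises the r-th power of
  -- the norm by at most τ^r. Since r > 1 this is o(τ), which leaves room only for a small value of
  -- f at v.
  obtain ⟨τ, hτ0, hτ⟩ : ∃ τ : ℝ, 0 < τ ∧ ‖f‖ * τ ^ (r - 1) ≤ ε / 2 := by
    have h1 : Tendsto (fun τ : ℝ => ‖f‖ * τ ^ (r - 1)) (𝓝[>] 0) (𝓝 0) := by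
      have := ((Real.continuousAt_rpow_const 0 (r - 1) (Or.inr (by linarith))).tendsto.const_mul
        ‖f‖).mono_left (nhdsWithin_le_nhds (s := Set.Ioi 0))
      rwa [Real.zero_rpow (by linarith), mul_zero] at this
    obtain ⟨τ, h2, h3⟩ := ((h1.eventually (gt_mem_nhds (half_pos hε))).and
      self_mem_nhdsWithin).exists
    exact ⟨τ, h3, h2.le⟩
  obtain ⟨u, s, hu1, hus, hfu⟩ : ∃ (u : Ell N q) (s : Finset (Lat N)), ‖u‖ ≤ 1 ∧
      (∀ x, x ∉ s → u x = 0) ∧ ‖f‖ - τ * (ε / 2) < ‖f u‖ := by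
    obtain ⟨w, hw, hfw⟩ := f.exists_lt_apply_of_lt_opNorm
      (show ‖f‖ - τ * (ε / 2) < ‖f‖ by linarith [mul_pos hτ0 (half_pos hε)])
    have h1 := (f.continuous.tendsto w).comp (tendsto_finProj hq w)
    obtain ⟨s, h2, h3⟩ := ((h1.norm.eventually (lt_mem_nhds hfw)).and
      ((tendsto_finProj hq w).norm.eventually (gt_mem_nhds hw))).exists
    exact ⟨finProj q s w, s, h3.le, fun x hx => by rw [finProj_apply, if_neg hx], h2⟩
  refine ⟨s, fun v hv => ?_⟩
  have key : ∀ v : Ell N q, (∀ x ∈ s, v x = 0) → ‖v‖ ≤ 1 → ‖f v‖ ≤ ε := by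
    intro v hv hv1
    obtain ⟨c, hc1, hc⟩ : ∃ c : ℂ, ‖c‖ ≤ 1 ∧ ‖f u + c * (τ * f v)‖ = ‖f u‖ + τ * ‖f v‖ := by
      simpa [abs_of_pos hτ0] using exists_phase (f u) (τ * f v)
    have h2 : ‖u + (c * τ) • v‖ ^ r ≤ 1 + τ ^ r := by
      refine (norm_add_rpow_le_of_disjoint hr0 _ _ fun x => ?_).trans (add_le_add ?_ ?_)
      · by_cases hx : x ∈ s
        · right; simp [hv x hx]
        · left; exact hus x hx
      · exact Real.rpow_le_one (norm_nonneg _) hu1 hr0.le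
      · refine Real.rpow_le_rpow (norm_nonneg _) ?_ hr0.le
        rw [norm_smul, norm_mul, Complex.norm_real, Real.norm_of_nonneg hτ0.le]
        calc ‖c‖ * τ * ‖v‖ ≤ 1 * τ * 1 := by gcongr
          _ = τ := by ring
    -- A number that is at least 1 does not exceed its r-th power.
    have h3 : ‖u + (c * τ) • v‖ ≤ 1 + τ ^ r := by
      by_contra! h
      have h4 : 1 ≤ ‖u + (c * τ) • v‖ := by
        have : 0 ≤ τ ^ r := Real.rpow_nonneg hτ0.le _
        linarith
      have h5 := Real.self_le_rpow_of_one_le h4 hr1.le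
      linarith
    have h4 : ‖f u‖ + τ * ‖f v‖ ≤ ‖f‖ * (1 + τ ^ r) := by
      rw [← hc]
      calc ‖f u + c * (τ * f v)‖ = ‖f (u + (c * τ) • v)‖ := by
            rw [map_add, map_smul, smul_eq_mul, mul_assoc]
        _ ≤ ‖f‖ * ‖u + (c * τ) • v‖ := f.le_opNorm _
        _ ≤ _ := by gcongr
    have h5 : τ ^ r = τ * τ ^ (r - 1) := by
      rw [Real.rpow_sub_one hτ0.ne']; field_simp
    -- The two losses, τε/2 from the choice of u and ‖f‖τ^r ≤ τε/2 from the choice of τ, add up to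
    -- τε.
    have h6 : τ * ‖f v‖ ≤ τ * ε := by
      rw [h5] at h4
      nlinarith [mul_le_mul_of_nonneg_left hτ hτ0.le]
    exact le_of_mul_le_mul_left h6 hτ0
  rcases eq_or_ne v 0 with rfl | hv0
  · simp
  have hn : (‖v‖ : ℝ) ≠ 0 := norm_ne_zero_iff.2 hv0
  have := key (((‖v‖ : ℝ)⁻¹ : ℂ) • v) (fun x hx => by simp [hv x hx]) (by
    rw [norm_smul, norm_inv, Complex.norm_real, norm_norm, inv_mul_cancel₀ hn])
  rw [map_smul, norm_smul, norm_inv, Complex.norm_real, norm_norm,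
    inv_mul_le_iff₀ (by positivity)] at this
  linarith [mul_comm ε ‖v‖]

/-- Functionals of finite support are dense in the dual. This needs 1 < q: on l^1 the summation
functional is not such a limit. -/
theorem tendsto_comp_finProj (hq1 : 1 < q) (hq : q ≠ ∞) (f : Ell N q →L[ℂ] ℂ) :
    Tendsto (fun s => f ∘L finProj q s) atTop (𝓝 f) := by
  rw [tendsto_iff_norm_sub_tendsto_zero, Metric.tendsto_atTop]
  intro ε hε
  obtain ⟨s, hs⟩ := exists_finset_functional_le hq1 hq f (half_pos hε)
  refine ⟨s, fun t ht => ?_⟩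
  rw [dist_zero_right, norm_norm]
  refine lt_of_le_of_lt (ContinuousLinearMap.opNorm_le_bound _ (half_pos hε).le fun v => ?_)
    (half_lt_self hε)
  have h1 : (f ∘L finProj q t - f) v = - f (v - finProj q t v) := by simp
  rw [h1, norm_neg]
  refine (hs _ fun x hx => ?_).trans ?_
  · simp [finProj_apply, ht hx]
  · gcongr
    refine lp.norm_mono (exponent_ne_zero q) fun x => ?_
    rw [lp.coeFn_sub, Pi.sub_apply, finProj_apply]
    split_ifs <;> simp

/-- A functional of finite support is a finite combination of evaluations, for which the row bound
gives norm convergence; the rest is density and equiboundedness of the adjoints. -/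
theorem tendsto_functional_comp_toOp (hq1 : 1 < q) (hq : q ≠ ∞) {C : ℕ → Wiener N}
    {g : Lat N → ℝ} (hg : Summable g) (hC : ∀ j α, ‖(C j).coeff α‖ ≤ g α)
    (h0 : ∀ α x, Tendsto (fun j => (C j).coeff α x) atTop (𝓝 0)) (f : Ell N q →L[ℂ] ℂ) :
    Tendsto (fun j => f ∘L (C j).toOp q) atTop (𝓝 0) := by
  let T : ℕ → (Ell N q →L[ℂ] ℂ) →L[ℂ] (Ell N q →L[ℂ] ℂ) := fun j =>
    (ContinuousLinearMap.compL ℂ (Ell N q) (Ell N q) ℂ).flip ((C j).toOp q)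
  refine tendsto_zero_of_tendsto (C := ∑' α, g α) T (fun j => ?_) (tendsto_comp_finProj hq1 hq f)
    fun s => ?_
  · refine ContinuousLinearMap.opNorm_le_bound _
      ((tsum_nonneg fun _ => norm_nonneg _).trans
        ((C j).summable_norm.tsum_le_tsum (hC j) hg)) fun f => ?_
    refine (ContinuousLinearMap.opNorm_comp_le _ _).trans ?_
    rw [mul_comm]
    gcongr
    exact ((C j).norm_toOp_le q).trans ((C j).summable_norm.tsum_le_tsum (hC j) hg)
  · have h1 : ∀ j, T j (f ∘L finProj q s) = ∑ x ∈ s, f (lp.single q x (1 : ℂ)) •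
        (lp.evalCLM ℂ (fun _ : Lat N => ℂ) q x ∘L (C j).toOp q) := by
      intro j
      ext u
      change f (finProj q s ((C j).toOp q u)) = _
      rw [finProj_eq, map_sum, _root_.sum_apply]
      refine Finset.sum_congr rfl fun x _ => ?_
      change _ = f (lp.single q x (1 : ℂ)) * (C j).toOp q u x
      rw [mul_comm, ← smul_eq_mul, ← map_smul, ← lp.single_smul, smul_eq_mul, mul_one]
    simp only [h1]
    rw [← Finset.sum_const_zero (s := s)]
    refine tendsto_finsetSum _ fun x _ => ?_
    have := (tendsto_eval_comp_toOp q hg hC h0 x).const_smul (f (lp.single q x (1 : ℂ)))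
    rwa [smul_zero] at this

end Dual

/-! ### Limit operators and limits of coefficients -/

/-- The coefficients of `B` are the limits of the coefficients of `A` along `h`. -/
def CoeffLimit (A : Wiener N) (h : ℕ → Lat N) (B : Wiener N) : Prop :=
  ∀ α x, Tendsto (fun j => A.coeff α (x + h j)) atTop (𝓝 (B.coeff α x))

section CoeffLimit

variable {A B : Wiener N} {h : ℕ → Lat N}

theorem CoeffLimit.diff_tendsto (H : CoeffLimit A h B) (α x : Lat N) :
    Tendsto (fun j => ((A.translate (h j)).diff B).coeff α x) atTop (𝓝 0) := by
  have := (H α x).sub_const (B.coeff α x)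
  rw [sub_self] at this
  refine this.congr fun j => ?_
  simp [Wiener.diff]

theorem norm_translate_diff_le (A B : Wiener N) (h α : Lat N) :
    ‖((A.translate h).diff B).coeff α‖ ≤ ‖A.coeff α‖ + ‖B.coeff α‖ := by
  rw [← A.norm_translate_coeff h α]
  exact norm_sub_le _ _

theorem CoeffLimit.tendsto_apply (H : CoeffLimit A h B) (p : ℝ≥0∞) [Fact (1 ≤ p)] (u : Ell N p)
    (hu : HasSum (fun x => (lp.single p x (u x) : Ell N p)) u) :
    Tendsto (fun j => (A.translate (h j)).toOp p u) atTop (𝓝 (B.toOp p u)) := by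
  have := tendsto_toOp_apply p (A.summable_norm.add B.summable_norm)
    (fun j => norm_translate_diff_le A B (h j)) H.diff_tendsto u hu
  rw [tendsto_iff_norm_sub_tendsto_zero, ← tendsto_zero_iff_norm_tendsto_zero]
  refine this.congr fun j => ?_
  rw [Wiener.toOp_diff]
  rfl

/-- Together with `exists_coeffLimit_of_isLimitOp` this describes op(A) on l^q in terms that do not
involve q. -/
theorem CoeffLimit.isLimitOp (H : CoeffLimit A h B) {q : ℝ≥0∞} [Fact (1 ≤ q)] (hq1 : 1 < q)
    (hq : q ≠ ∞) : IsLimitOp (A.toOp q) h (B.toOp q) := by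
  refine ⟨fun u => ?_, fun f => ?_⟩
  · simpa only [Wiener.toOp_translate] using H.tendsto_apply q u (lp.hasSum_single hq u)
  · have := tendsto_functional_comp_toOp hq1 hq (A.summable_norm.add B.summable_norm)
      (fun j => norm_translate_diff_le A B (h j)) H.diff_tendsto f
    rw [tendsto_iff_norm_sub_tendsto_zero, ← tendsto_zero_iff_norm_tendsto_zero]
    refine this.congr fun j => ?_
    rw [Wiener.toOp_diff, ContinuousLinearMap.comp_sub, Wiener.toOp_translate]

/-- Every limit operator of `A` on `l^q`, `q < ∞`, belongs to the Wiener algebra. -/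
theorem exists_coeffLimit_of_isLimitOp {q : ℝ≥0∞} [Fact (1 ≤ q)] (hq : q ≠ ∞)
    {T : Ell N q →L[ℂ] Ell N q} (H : IsLimitOp (A.toOp q) h T) :
    ∃ B : Wiener N, CoeffLimit A h B ∧ B.toOp q = T := by
  -- The number a_α(x + h(j)) is the matrix entry of V_{-h(j)} A V_{h(j)} in row x and column x - α,
  -- so strong convergence on delta functions suffices.
  have hlim : ∀ α x, Tendsto (fun j => A.coeff α (x + h j)) atTop
      (𝓝 (T (lp.single q (x - α) (1 : ℂ)) x)) := by
    intro α x
    have h1 := ((lp.evalCLM ℂ (fun _ : Lat N => ℂ) q x).continuous.tendsto _).comp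
      (H.1 (lp.single q (x - α) (1 : ℂ)))
    refine h1.congr fun j => ?_
    change (shift q (-h j) ∘L A.toOp q ∘L shift q (h j)) (lp.single q (x - α) (1 : ℂ)) x = _
    rw [← Wiener.toOp_translate]
    rw [Wiener.toOp_single_apply, sub_sub_cancel, mul_one, Wiener.translate_coeff_apply]
  have hb : ∀ α x, ‖T (lp.single q (x - α) (1 : ℂ)) x‖ ≤ ‖A.coeff α‖ := fun α x =>
    le_of_tendsto (hlim α x).norm
      (Eventually.of_forall fun j => lp.norm_apply_le_norm ENNReal.top_ne_zero _ _)
  let b : Lat N → Ell N ∞ := fun α => ⟨fun x => T (lp.single q (x - α) (1 : ℂ)) x,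
    memℓp_infty ⟨‖A.coeff α‖, by rintro _ ⟨x, rfl⟩; exact hb α x⟩⟩
  let B : Wiener N := ⟨b, Summable.of_nonneg_of_le (fun _ => norm_nonneg _)
    (fun α => lp.norm_le_of_forall_le (norm_nonneg _) (hb α)) A.summable_norm⟩
  refine ⟨B, hlim, ?_⟩
  refine ContinuousLinearMap.ext fun u => ?_
  have h1 := (lp.hasSum_single hq u).mapL (B.toOp q)
  have h2 := (lp.hasSum_single hq u).mapL T
  refine h1.unique (h2.congr_fun fun y => ?_)
  have h3 : ∀ c : ℂ, B.toOp q (lp.single q y c) = T (lp.single q y c) := by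
    intro c
    have h4 : B.toOp q (lp.single q y (1 : ℂ)) = T (lp.single q y (1 : ℂ)) := by
      ext x
      rw [Wiener.toOp_single_apply, mul_one]
      change T (lp.single q (x - (x - y)) (1 : ℂ)) x = _
      rw [sub_sub_cancel]
    have h5 : (lp.single q y c : Ell N q) = c • lp.single q y (1 : ℂ) := by
      rw [← lp.single_smul, smul_eq_mul, mul_one]
    rw [h5, map_smul, map_smul, h4]
  exact h3 _

/-- The coefficients are the matrix entries of the operator, so the symbol depends on the operator
alone. -/
theorem Wiener.coeff_eq_of_toOp_eq {q : ℝ≥0∞} [Fact (1 ≤ q)] (h : A.toOp q = B.toOp q)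
    (α : Lat N) : A.coeff α = B.coeff α := by
  ext x
  have := A.toOp_single_apply q (x - α) x 1
  rw [h, B.toOp_single_apply, sub_sub_cancel, mul_one, mul_one] at this
  exact this.symm

end CoeffLimit

/-! ### Asymptotic periods -/

/-- The functions with asymptotic period `d`. -/
def asymPeriodic (d : Lat N) : Subalgebra ℂ (Ell N ∞) where
  carrier := {a | Tendsto (fun x : Lat N => a (x + d) - a x) cofinite (𝓝 0)}
  mul_mem' := by
    intro a b ha hb
    have h1 : Tendsto (fun x : Lat N => (a (x + d) - a x) * b (x + d) + a x * (b (x + d) - b x))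
        cofinite (𝓝 0) := by
      have e1 := ha.zero_mul_isBoundedUnder_le (g := fun x => b (x + d))
        (isBoundedUnder_of ⟨‖b‖, fun x => lp.norm_apply_le_norm ENNReal.top_ne_zero _ _⟩)
      have e2 := isBoundedUnder_le_mul_tendsto_zero (f := fun x => a x)
        (isBoundedUnder_of ⟨‖a‖, fun x => lp.norm_apply_le_norm ENNReal.top_ne_zero _ _⟩) hb
      simpa using e1.add e2
    refine h1.congr fun x => ?_
    rw [lp.infty_coeFn_mul, Pi.mul_apply, Pi.mul_apply]
    ring
  add_mem' := by
    intro a b ha hb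
    have := ha.add hb
    rw [add_zero] at this
    refine this.congr fun x => ?_
    rw [lp.coeFn_add, Pi.add_apply, Pi.add_apply]
    ring
  algebraMap_mem' := by
    intro c
    refine tendsto_const_nhds.congr fun x => ?_
    change (0 : ℂ) = c - c
    rw [sub_self]

theorem mem_asymPeriodic {d : Lat N} {a : Ell N ∞} :
    a ∈ asymPeriodic d ↔ Tendsto (fun x : Lat N => a (x + d) - a x) cofinite (𝓝 0) := Iff.rfl

theorem isClosed_asymPeriodic (d : Lat N) : IsClosed (asymPeriodic d : Set (Ell N ∞)) := by
  refine isClosed_of_closure_subset fun a ha => ?_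
  refine Metric.tendsto_nhds.2 fun ε hε => ?_
  obtain ⟨b, hb, hab⟩ := Metric.mem_closure_iff.1 ha (ε / 3) (by positivity)
  filter_upwards [Metric.tendsto_nhds.1 hb (ε / 3) (by positivity)] with x hx
  rw [dist_zero_right] at hx ⊢
  rw [dist_eq_norm] at hab
  have h1 := lp.norm_apply_le_norm ENNReal.top_ne_zero (a - b) (x + d)
  have h2 := lp.norm_apply_le_norm ENNReal.top_ne_zero (a - b) x
  rw [lp.coeFn_sub, Pi.sub_apply] at h1 h2
  calc ‖a (x + d) - a x‖
      = ‖(a (x + d) - b (x + d)) + (b (x + d) - b x) - (a x - b x)‖ := by congr 1; ring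
    _ ≤ ‖(a (x + d) - b (x + d)) + (b (x + d) - b x)‖ + ‖a x - b x‖ := norm_sub_le _ _
    _ ≤ ‖a (x + d) - b (x + d)‖ + ‖b (x + d) - b x‖ + ‖a x - b x‖ := by
        gcongr
        exact norm_add_le _ _
    _ < ε := by linarith

theorem tendsto_add_cofinite (d : Lat N) : Tendsto (fun x : Lat N => x + d) cofinite cofinite :=
  (add_left_injective d).tendsto_cofinite

/-- The asymptotic periods of a function form a group. -/
def asymPeriods (a : Ell N ∞) : AddSubgroup (Lat N) where
  carrier := {d | a ∈ asymPeriodic d}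
  zero_mem' := tendsto_const_nhds.congr fun x => by rw [add_zero, sub_self]
  add_mem' := by
    intro d e hd he
    have := (hd.comp (tendsto_add_cofinite e)).add he
    rw [add_zero] at this
    refine this.congr fun x => ?_
    simp only [Function.comp_apply]
    rw [show x + e + d = x + (d + e) by abel]
    ring
  neg_mem' := by
    intro d hd
    have := (hd.comp (tendsto_add_cofinite (-d))).neg
    rw [neg_zero] at this
    refine this.congr fun x => ?_
    simp

/-- The algebra of slowly oscillating functions. -/
def slowlyOscillatingAlgebra (N : ℕ) : Subalgebra ℂ (Ell N ∞) := ⨅ d, asymPeriodic d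

theorem mem_slowlyOscillatingAlgebra {a : Ell N ∞} :
    a ∈ slowlyOscillatingAlgebra N ↔
      ∀ d : Lat N, Tendsto (fun x : Lat N => a (x + d) - a x) cofinite (𝓝 0) := by
  simp only [slowlyOscillatingAlgebra, Algebra.mem_iInf, mem_asymPeriodic]

/-! ### The periodicity cell -/

section Cell

variable (r : Fin N → ℕ)

/-- The lattice point `(r_1 β_1, …, r_N β_N)`. -/
def scale (β : Lat N) : Lat N := fun k => r k * β k

/-- The coordinatewise quotients of `x` by `r`. -/
def cellQuot (x : Lat N) : Lat N := fun k => x k / r k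

/-- The lattice point with coordinates in the periodicity cell. -/
def cellPoint {r : Fin N → ℕ} (i : Cell r) : Lat N := fun k => ((i k : ℕ) : ℤ)

variable [∀ k, NeZero (r k)]

/-- The coordinatewise remainders of `x` modulo `r`. -/
def cellRem (x : Lat N) : Cell r := fun k => ⟨(x k % r k).toNat, by
  have h : (0 : ℤ) < r k := by exact_mod_cast Nat.pos_of_ne_zero (NeZero.ne (r k))
  have h1 := Int.emod_nonneg (x k) h.ne'
  have h2 := Int.emod_lt_of_pos (x k) h
  omega⟩

theorem cast_pos (k : Fin N) : (0 : ℤ) < r k := by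
  exact_mod_cast Nat.pos_of_ne_zero (NeZero.ne (r k))

theorem cellPoint_cellRem_apply (x : Lat N) (k : Fin N) :
    cellPoint (cellRem r x) k = x k % r k :=
  Int.toNat_of_nonneg (Int.emod_nonneg (x k) (cast_pos r k).ne')

theorem cellPoint_add_scale (x : Lat N) :
    cellPoint (cellRem r x) + scale r (cellQuot r x) = x := by
  ext k
  rw [Pi.add_apply, cellPoint_cellRem_apply]
  exact Int.emod_add_mul_ediv (x k) (r k)

omit [∀ k, NeZero (r k)] in
theorem scale_add (β γ : Lat N) : scale r (β + γ) = scale r β + scale r γ := by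
  ext k; simp [scale, mul_add]

omit [∀ k, NeZero (r k)] in
theorem scale_neg (β : Lat N) : scale r (-β) = -scale r β := by
  ext k; simp [scale]

theorem scale_injective : Function.Injective (scale r) := by
  intro β γ h
  ext k
  have := congr_fun h k
  exact mul_left_cancel₀ (cast_pos r k).ne' this

theorem cellRem_add_scale (x β : Lat N) : cellRem r (x + scale r β) = cellRem r x := by
  ext k
  simp [cellRem, scale]

theorem cellQuot_add_scale (x β : Lat N) : cellQuot r (x + scale r β) = cellQuot r x + β := by
  ext k
  simp [cellQuot, scale, Int.add_mul_ediv_left _ _ (cast_pos r k).ne']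

theorem cellRem_cellPoint (i : Cell r) : cellRem r (cellPoint i) = i := by
  ext k
  have h : ((i k : ℕ) : ℤ) < r k := by exact_mod_cast (i k).2
  simp [cellRem, cellPoint, Int.emod_eq_of_lt (Int.natCast_nonneg _) h]

theorem cellRem_add_congr {x x' : Lat N} (h : cellRem r x = cellRem r x') (y : Lat N) :
    cellRem r (x + y) = cellRem r (x' + y) := by
  conv_lhs => rw [← cellPoint_add_scale r x, h]
  conv_rhs => rw [← cellPoint_add_scale r x']
  rw [add_right_comm, cellRem_add_scale, add_right_comm, cellRem_add_scale]

theorem cellQuot_add (x y : Lat N) :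
    cellQuot r (x + y) = cellQuot r x + cellQuot r (cellPoint (cellRem r x) + y) := by
  conv_lhs => rw [← cellPoint_add_scale r x]
  rw [add_right_comm, cellQuot_add_scale, add_comm]

omit [∀ k, NeZero (r k)] in
theorem scale_eq_sum (β : Lat N) :
    scale r β = ∑ k, β k • (Pi.single k (r k : ℤ) : Lat N) := by
  ext l
  simp [scale, Finset.sum_apply, Pi.single_apply, mul_comm]

/-- The corner `x - (x mod r)` of the translated cell containing `x`, shifted by `i`, tends to
infinity with `x`. -/
theorem tendsto_scale_cellQuot (y : Lat N) :
    Tendsto (fun x => scale r (cellQuot r x) + y) cofinite cofinite := by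
  refine (tendsto_add_cofinite y).comp ?_
  refine (scale_injective r).tendsto_cofinite.comp ?_
  refine Tendsto.cofinite_of_finite_preimage_singleton fun β => ?_
  refine (Set.finite_range fun i : Cell r => cellPoint i + scale r β).subset ?_
  rintro x rfl
  exact ⟨cellRem r x, cellPoint_add_scale r x⟩

/-! ### Semi-periodic functions -/

variable {r}

omit [∀ k, NeZero (r k)] in
-- Having asymptotic period r_k e_k defines a closed subalgebra containing the generators, and
-- asymptotic periods form a group. This is the only property of SP_r that the proof uses.
theorem scale_mem_asymPeriods {a : Ell N ∞} (ha : a ∈ semiPeriodic r) (β : Lat N) :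
    scale r β ∈ asymPeriods a := by
  rw [scale_eq_sum]
  refine sum_mem fun k _ => zsmul_mem ?_ _
  refine Subalgebra.topologicalClosure_minimal (t := asymPeriodic (Pi.single k (r k : ℤ)))
    (Algebra.adjoin_le ?_) (isClosed_asymPeriodic _) ha
  rintro b (hb | hb)
  · exact hb _
  · refine tendsto_const_nhds.congr fun x => ?_
    rw [hb k x, sub_self]

/-- The function which is constant on translated cells, with the value of `a` at the point of the
cell corresponding to `i`. -/
def cellSample (a : Ell N ∞) (i : Cell r) : Ell N ∞ :=
  ⟨fun x => a (scale r (cellQuot r x) + cellPoint i), memℓp_infty ⟨‖a‖, by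
    rintro _ ⟨x, rfl⟩
    exact lp.norm_apply_le_norm ENNReal.top_ne_zero a _⟩⟩

omit [∀ k, NeZero (r k)] in
theorem cellSample_apply (a : Ell N ∞) (i : Cell r) (x : Lat N) :
    cellSample a i x = a (scale r (cellQuot r x) + cellPoint i) := rfl

omit [∀ k, NeZero (r k)] in
theorem norm_cellSample_le (a : Ell N ∞) (i : Cell r) : ‖cellSample a i‖ ≤ ‖a‖ :=
  lp.norm_le_of_forall_le (norm_nonneg _)
    fun _ => lp.norm_apply_le_norm ENNReal.top_ne_zero a _

/-- Moving x by y moves the corner of its cell by a multiple of r that depends only on the residue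
of x. Finitely many such vectors occur, and each is an asymptotic period of `a`. -/
theorem cellSample_mem {a : Ell N ∞} (ha : a ∈ semiPeriodic r) (i : Cell r) :
    cellSample a i ∈ slowlyOscillatingAlgebra N := by
  rw [mem_slowlyOscillatingAlgebra]
  intro y
  let G : Cell r → Lat N → ℂ := fun j z =>
    a (z + scale r (cellQuot r (cellPoint j + y))) - a z
  have hG : Tendsto (fun x => ∑ j : Cell r, ‖G j (scale r (cellQuot r x) + cellPoint i)‖)
      cofinite (𝓝 0) := by
    rw [← Finset.sum_const_zero (s := (Finset.univ : Finset (Cell r)))]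
    refine tendsto_finsetSum _ fun j _ => ?_
    have h1 := scale_mem_asymPeriods ha (cellQuot r (cellPoint j + y))
    have := (Tendsto.comp h1 (tendsto_scale_cellQuot r (cellPoint i))).norm
    rwa [norm_zero] at this
  refine squeeze_zero_norm (fun x => ?_) hG
  refine le_trans (le_of_eq ?_) (Finset.single_le_sum (f := fun j =>
    ‖G j (scale r (cellQuot r x) + cellPoint i)‖) (fun j _ => norm_nonneg _)
    (Finset.mem_univ (cellRem r x)))
  simp only [cellSample_apply, G]
  rw [cellQuot_add, scale_add, add_right_comm]

omit [∀ k, NeZero (r k)] in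
theorem periodic_add_scale {b : Ell N ∞} (hb : b ∈ periodic r) (x β : Lat N) :
    b (x + scale r β) = b x := by
  let P : AddSubgroup (Lat N) :=
    { carrier := {d | ∀ x, b (x + d) = b x}
      zero_mem' := by simp
      add_mem' := by
        intro d e hd he x
        rw [← add_assoc, he, hd]
      neg_mem' := by
        intro d hd x
        rw [← hd (x + -d), neg_add_cancel_right] }
  have : scale r β ∈ P := by
    rw [scale_eq_sum]
    exact sum_mem fun k _ => zsmul_mem (show Pi.single k (r k : ℤ) ∈ P from hb k) _
  exact this x

theorem periodic_eq_cellRem {b : Ell N ∞} (hb : b ∈ periodic r) (x : Lat N) :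
    b x = b (cellPoint (cellRem r x)) := by
  conv_lhs => rw [← cellPoint_add_scale r x]
  exact periodic_add_scale hb _ _

omit [∀ k, NeZero (r k)] in
/-- Limits of semi-periodic coefficients are periodic. -/
theorem CoeffLimit.mem_wienerPeriodic {A B : Wiener N} {h : ℕ → Lat N} (H : CoeffLimit A h B)
    (hA : A ∈ wienerSemiPeriodic r) (hh : Tendsto h atTop cofinite) : B ∈ wienerPeriodic r := by
  intro α k x
  have h1 : Pi.single k (r k : ℤ) ∈ asymPeriods (A.coeff α) := by
    have := scale_mem_asymPeriods (hA α) (Pi.single k 1)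
    have e : scale r (Pi.single k 1) = Pi.single k (r k : ℤ) := by
      ext l
      by_cases hl : l = k
      · subst hl; simp [scale]
      · simp [scale, hl]
    rwa [e] at this
  have h2 : Tendsto (fun j => x + h j) atTop cofinite :=
    ((add_right_injective x).tendsto_cofinite).comp hh
  have h3 := Tendsto.comp h1 h2
  have h4 := (H α (x + Pi.single k (r k : ℤ))).sub (H α x)
  refine sub_eq_zero.1 (tendsto_nhds_unique h4 (h3.congr fun j => ?_))
  simp only [Function.comp_apply]
  rw [add_right_comm]

end Cell

/-! ### Characters of the algebra of slowly oscillating functions -/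

section Characters

/-- The inverse of a slowly oscillating function which is real and bounded away from zero at
infinity, up to a finitely supported function. -/
theorem exists_inverse_mem {g : Ell N ∞} (hg : g ∈ slowlyOscillatingAlgebra N) {ε : ℝ}
    (hε : 0 < ε) (w : Lat N → ℝ) (hw : ∀ x, g x = w x) (hge : ∀ᶠ x in cofinite, ε ≤ w x) :
    ∃ k ∈ slowlyOscillatingAlgebra N, ∀ᶠ x in cofinite, g x * k x = 1 := by
  -- The cut-off makes the reciprocal bounded everywhere and changes w only at finitely many points.
  let m : Lat N → ℝ := fun x => max (w x) ε
  have hm : ∀ x, ε ≤ m x := fun x => le_max_right _ _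
  have hm0 : ∀ x, 0 < m x := fun x => hε.trans_le (hm x)
  refine ⟨⟨fun x => ((m x)⁻¹ : ℝ), memℓp_infty ⟨ε⁻¹, ?_⟩⟩, ?_, ?_⟩
  · rintro _ ⟨x, rfl⟩
    change ‖(((m x)⁻¹ : ℝ) : ℂ)‖ ≤ _
    rw [Complex.norm_real, Real.norm_of_nonneg (inv_nonneg.2 (hm0 x).le)]
    exact inv_anti₀ hε (hm x)
  · rw [mem_slowlyOscillatingAlgebra] at hg ⊢
    intro d
    have h1 := ((hg d).norm.const_mul (ε⁻¹ * ε⁻¹))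
    rw [norm_zero, mul_zero] at h1
    refine squeeze_zero_norm (fun x => ?_) h1
    change ‖(((m (x + d))⁻¹ : ℝ) : ℂ) - (((m x)⁻¹ : ℝ) : ℂ)‖ ≤ _
    rw [← Complex.ofReal_sub, Complex.norm_real, hw, hw, ← Complex.ofReal_sub, Complex.norm_real,
      inv_sub_inv (hm0 _).ne' (hm0 _).ne', norm_div, Real.norm_eq_abs, Real.norm_eq_abs,
      Real.norm_eq_abs, div_eq_mul_inv, mul_comm, abs_of_pos (mul_pos (hm0 _) (hm0 _)), mul_inv]
    refine mul_le_mul ?_ ?_ (abs_nonneg _) (by positivity)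
    · exact mul_le_mul (inv_anti₀ hε (hm _)) (inv_anti₀ hε (hm _))
        (inv_nonneg.2 (hm0 _).le) (by positivity)
    · rw [abs_sub_comm]
      exact abs_max_sub_max_le_abs _ _ _
  · filter_upwards [hge] with x hx
    change g x * (((m x)⁻¹ : ℝ) : ℂ) = 1
    rw [hw, ← Complex.ofReal_mul, show m x = w x from max_eq_left hx,
      mul_inv_cancel₀ (hε.trans_le hx).ne', Complex.ofReal_one]

theorem star_mem_slowlyOscillatingAlgebra {f : Ell N ∞} (hf : f ∈ slowlyOscillatingAlgebra N) :
    star f ∈ slowlyOscillatingAlgebra N := by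
  rw [mem_slowlyOscillatingAlgebra] at hf ⊢
  intro d
  have := (hf d).star
  rw [star_zero] at this
  refine this.congr fun x => ?_
  rw [star_sub]
  rfl

/-- A character of the algebra of slowly oscillating functions which vanishes on the functions
tending to zero at infinity is, on countably many functions, the limit along a sequence. -/
theorem exists_seq_tendsto_character (ψ : slowlyOscillatingAlgebra N →ₐ[ℂ] ℂ)
    (hψ : ∀ f : slowlyOscillatingAlgebra N, Tendsto (fun x => (f : Ell N ∞) x) cofinite (𝓝 0) →
      ψ f = 0) {κ : Type*} [Countable κ] (f : κ → slowlyOscillatingAlgebra N) :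
    ∃ y : ℕ → Lat N, Tendsto y atTop cofinite ∧
      ∀ m, Tendsto (fun n => (f m : Ell N ∞) (y n)) atTop (𝓝 (ψ (f m))) := by
  let F : Lat N → κ → ℂ := fun x m => (f m : Ell N ∞) x
  let c : κ → ℂ := fun m => ψ (f m)
  -- It suffices that c is a cluster value of F at infinity; as κ is countable, the filter is
  -- countably generated and a sequence can be extracted.
  have hne : (cofinite ⊓ comap F (𝓝 c)).NeBot := by
    rw [inf_neBot_iff_frequently_right]
    intro P hP
    obtain ⟨U, hU, hUP⟩ := hP
    by_contra hnot
    rw [not_frequently] at hnot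
    rw [nhds_pi, Filter.mem_pi] at hU
    obtain ⟨I, hI, t, ht, htU⟩ := hU
    obtain ⟨ε, hε, hεt⟩ : ∃ ε > 0, ∀ m ∈ I, Metric.ball (c m) ε ⊆ t m := by
      have h1 : ∀ᶠ ε in 𝓝[>] (0 : ℝ), ∀ m ∈ I, Metric.ball (c m) ε ⊆ t m := by
        refine (eventually_all_finite hI).2 fun m _ => ?_
        obtain ⟨e, he, het⟩ := Metric.mem_nhds_iff.1 (ht m)
        filter_upwards [Ioo_mem_nhdsGT he] with ε hε
        exact (Metric.ball_subset_ball hε.2.le).trans het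
      obtain ⟨ε, h2, h3⟩ := (h1.and self_mem_nhdsWithin).exists
      exact ⟨ε, h3, h2⟩
    let s := hI.toFinset
    let z : κ → slowlyOscillatingAlgebra N := fun m => f m - algebraMap ℂ _ (c m)
    let zs : κ → slowlyOscillatingAlgebra N := fun m =>
      ⟨star (z m : Ell N ∞), star_mem_slowlyOscillatingAlgebra (z m).2⟩
    -- Here g = ∑ |f_m - c_m|², and ψ(g) = 0 because each summand has the factor z_m in the kernel.
    -- If c were not a cluster value, g would be bounded below off a finite set, hence invertible
    -- modulo functions that ψ kills.
    let g : slowlyOscillatingAlgebra N := ∑ m ∈ s, zs m * z m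
    have hψg : ψ g = 0 := by
      simp only [g, map_sum, map_mul]
      refine Finset.sum_eq_zero fun m _ => ?_
      have : ψ (z m) = 0 := by simp [z, c]
      rw [this, mul_zero]
    have hz : ∀ m x, (z m : Ell N ∞) x = F x m - c m := fun m x => rfl
    have hg : ∀ x, (g : Ell N ∞) x = ((∑ m ∈ s, ‖F x m - c m‖ ^ 2 : ℝ) : ℂ) := by
      intro x
      rw [Complex.ofReal_sum]
      refine (map_sum ((lp.evalCLM ℂ (fun _ : Lat N => ℂ) ∞ x).toLinearMap ∘ₗ
        (slowlyOscillatingAlgebra N).val.toLinearMap) (fun m => zs m * z m) s).trans ?_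
      refine Finset.sum_congr rfl fun m _ => ?_
      change star ((z m : Ell N ∞) x) * (z m : Ell N ∞) x = _
      rw [hz, Complex.star_def, mul_comm, Complex.mul_conj']
      push_cast
      rfl
    have hge : ∀ᶠ x in cofinite, ε ^ 2 ≤ ∑ m ∈ s, ‖F x m - c m‖ ^ 2 := by
      filter_upwards [hnot] with x hx
      have : ∃ m ∈ I, ε ≤ ‖F x m - c m‖ := by
        by_contra! hcon
        refine hx (hUP (htU fun m hm => hεt m hm ?_))
        rw [Metric.mem_ball, dist_eq_norm]
        exact hcon m hm
      obtain ⟨m, hm, hεm⟩ := this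
      refine le_trans ?_ (Finset.single_le_sum (f := fun m => ‖F x m - c m‖ ^ 2)
        (fun _ _ => sq_nonneg _) (hI.mem_toFinset.2 hm))
      exact pow_le_pow_left₀ hε.le hεm 2
    obtain ⟨k, hk, hgk⟩ := exists_inverse_mem g.2 (by positivity) _ hg hge
    have h1 := hψ (g * ⟨k, hk⟩ - 1) (tendsto_const_nhds.congr' (by
      filter_upwards [hgk] with x hx
      change (0 : ℂ) = (g : Ell N ∞) x * k x - 1
      rw [hx, sub_self]))
    rw [map_sub, map_mul, hψg, map_one, zero_mul, zero_sub] at h1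
    norm_num at h1
  have hcof : (cofinite : Filter (Lat N)).IsCountablyGenerated :=
    (HasCountableBasis.mk hasBasis_cofinite Set.Countable.ofPred_finite).isCountablyGenerated
  obtain ⟨y, hy⟩ := exists_seq_tendsto (cofinite ⊓ comap F (𝓝 c))
  rw [tendsto_inf, tendsto_comap_iff, tendsto_pi_nhds] at hy
  exact ⟨y, hy.1, hy.2⟩

end Characters

/-! ### Shifts and multiplication operators modulo approximable operators -/

section Operators

variable (p : ℝ≥0∞) [Fact (1 ≤ p)]

theorem shift_zero : shift p (0 : Lat N) = 1 := by
  ext u x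
  simp

theorem shift_mul_shift (α β : Lat N) : shift p α * shift p β = shift p (α + β) := by
  ext u x
  simp [sub_sub]

theorem shift_mul_mulOp (α : Lat N) (a : Ell N ∞) :
    shift p α * mulOp p a = mulOp p (shift ∞ α a) * shift p α := by
  ext u x
  simp

/-- Multiplication operators as a homomorphism of algebras. -/
def mulOpHom : Ell N ∞ →ₐ[ℂ] (Ell N p →L[ℂ] Ell N p) where
  toFun := mulOp p
  map_one' := by ext u x; simp
  map_zero' := by ext u x; simp
  map_mul' a b := by ext u x; simp [mul_assoc]
  map_add' a b := by ext u x; simp [add_mul]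
  commutes' c := by
    ext u x
    rfl

theorem mulOpHom_apply (a : Ell N ∞) : mulOpHom p a = mulOp p a := rfl

/-- Truncating `a` to the finite set where it is not small leaves a multiplier of finite rank, close
in norm. -/
theorem mulOp_mem_approximableIdeal {a : Ell N ∞}
    (ha : Tendsto (fun x => a x) cofinite (𝓝 0)) :
    mulOp p a ∈ approximableIdeal (Ell N p) := by
  refine Metric.mem_closure_iff.2 fun ε hε => ?_
  have hfin := Metric.tendsto_nhds.1 ha (ε / 2) (half_pos hε)
  rw [eventually_cofinite] at hfin
  let s := hfin.toFinset
  have hs : ∀ x ∉ s, ‖a x‖ ≤ ε / 2 := by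
    intro x hx
    rw [Set.Finite.mem_toFinset, Set.mem_ofPred_eq, not_not, dist_zero_right] at hx
    exact hx.le
  refine ⟨mulOp p (finProj ∞ s a), ?_, ?_⟩
  · have hr : (mulOp p (finProj ∞ s a) : Ell N p →ₗ[ℂ] Ell N p).range ≤
        Submodule.span ℂ ((fun x => (lp.single p x (1 : ℂ) : Ell N p)) '' s) := by
      rintro _ ⟨u, rfl⟩
      have : mulOp p (finProj ∞ s a) u
          = ∑ x ∈ s, (a x * u x) • (lp.single p x (1 : ℂ) : Ell N p) := by
        have h1 : ∀ x, (a x * u x) • (lp.single p x (1 : ℂ) : Ell N p)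
            = lp.single p x (a x * u x) := fun x => by
          rw [← lp.single_smul, smul_eq_mul, mul_one]
        simp only [h1]
        ext y
        rw [mulOp_apply, finProj_apply, lp.coeFn_sum, Finset.sum_apply]
        simp only [lp.coeFn_single, Pi.single_apply]
        rw [Finset.sum_ite_eq]
        split_ifs <;> simp
      change mulOp p (finProj ∞ s a) u ∈ _
      rw [this]
      exact sum_mem fun x hx => Submodule.smul_mem _ _ (Submodule.subset_span ⟨x, hx, rfl⟩)
    have : FiniteDimensional ℂ
        (Submodule.span ℂ ((fun x => (lp.single p x (1 : ℂ) : Ell N p)) '' s)) :=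
      FiniteDimensional.span_of_finite ℂ (s.finite_toSet.image _)
    have := Submodule.finiteDimensional_of_le hr
    exact (inferInstance : IsNoetherian ℂ (mulOp p (finProj ∞ s a) : Ell N p →ₗ[ℂ] Ell N p).range)
  · rw [dist_eq_norm, ← mulOpHom_apply, ← mulOpHom_apply, ← map_sub]
    refine ((norm_mulOp_le p _).trans ?_).trans_lt (half_lt_self hε)
    refine lp.norm_le_of_forall_le (half_pos hε).le fun x => ?_
    rw [lp.coeFn_sub, Pi.sub_apply, finProj_apply]
    split_ifs with h
    · rw [sub_self, norm_zero]; exact (half_pos hε).le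
    · rw [sub_zero]; exact hs x h

/-- The class of a multiplication operator modulo approximable operators. -/
def mulClass : Ell N ∞ →ₐ[ℂ] Calkin (Ell N p) := toCalkin.comp (mulOpHom p)

/-- The class of a shift modulo approximable operators. -/
def shiftClass (α : Lat N) : Calkin (Ell N p) := toCalkin (shift p α)

theorem mulClass_apply (a : Ell N ∞) : mulClass p a = toCalkin (mulOp p a) := rfl

theorem mulClass_eq_zero {a : Ell N ∞} (ha : Tendsto (fun x => a x) cofinite (𝓝 0)) :
    mulClass p a = 0 :=
  toCalkin_eq_zero.2 (mulOp_mem_approximableIdeal p ha)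

theorem mulClass_comm (a b : Ell N ∞) :
    mulClass p a * mulClass p b = mulClass p b * mulClass p a := by
  rw [← map_mul, ← map_mul, mul_comm]

theorem shiftClass_mul (α β : Lat N) :
    shiftClass p α * shiftClass p β = shiftClass p (α + β) := by
  rw [shiftClass, shiftClass, ← map_mul, shift_mul_shift, shiftClass]

theorem shiftClass_zero : shiftClass p (0 : Lat N) = 1 := by
  rw [shiftClass, shift_zero, map_one]

theorem norm_shiftClass_le (α : Lat N) : ‖shiftClass p α‖ ≤ 1 :=
  (norm_toCalkin_le _).trans (norm_shiftOp_le p α)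

theorem shiftClass_mul_mulClass (α : Lat N) (a : Ell N ∞) :
    shiftClass p α * mulClass p a = mulClass p (shift ∞ α a) * shiftClass p α := by
  rw [shiftClass, mulClass_apply, mulClass_apply, ← map_mul, ← map_mul, shift_mul_mulOp]

/-- The commutator is multiplication by a(x - α) - a(x), followed by the shift, and this function
tends to zero. -/
theorem shiftClass_comm_mulClass (α : Lat N) {a : Ell N ∞}
    (ha : a ∈ asymPeriodic (-α)) :
    shiftClass p α * mulClass p a = mulClass p a * shiftClass p α := by
  rw [shiftClass_mul_mulClass]
  congr 1
  rw [← sub_eq_zero, ← map_sub]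
  refine mulClass_eq_zero p (ha.congr fun x => ?_)
  rw [lp.coeFn_sub, Pi.sub_apply, shift_apply, sub_eq_add_neg x]

end Operators

/-! ### The block decomposition of operators with semi-periodic coefficients -/

section Blocks

variable (r : Fin N → ℕ) [∀ k, NeZero (r k)] (p : ℝ≥0∞) [Fact (1 ≤ p)]

/-- The classes of slowly oscillating multipliers and of shifts by multiples of the periods. -/
def blockGenerators : Set (Calkin (Ell N p)) :=
  mulClass p '' (slowlyOscillatingAlgebra N : Set (Ell N ∞)) ∪
    Set.range fun β : Lat N => shiftClass p (scale r β)

omit [∀ k, NeZero (r k)] in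
theorem blockGenerators_comm :
    ∀ a ∈ blockGenerators r p, ∀ b ∈ blockGenerators r p, a * b = b * a := by
  have hso : ∀ {f : Ell N ∞}, f ∈ slowlyOscillatingAlgebra N → ∀ d, f ∈ asymPeriodic d :=
    fun hf d => mem_slowlyOscillatingAlgebra.1 hf d
  rintro _ (⟨f, hf, rfl⟩ | ⟨β, rfl⟩) _ (⟨g, hg, rfl⟩ | ⟨γ, rfl⟩)
  · exact mulClass_comm p f g
  · exact (shiftClass_comm_mulClass p _ (hso hf _)).symm
  · exact shiftClass_comm_mulClass p _ (hso hg _)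
  · simp only [shiftClass_mul, add_comm]

/-- The indicator function of a residue class modulo `r`. -/
def cellIndicator (i : Cell r) : Ell N ∞ :=
  ⟨fun x => if cellRem r x = i then 1 else 0, memℓp_infty ⟨1, by
    rintro _ ⟨x, rfl⟩
    dsimp only
    split_ifs <;> simp⟩⟩

theorem cellIndicator_apply (i : Cell r) (x : Lat N) :
    cellIndicator r i x = if cellRem r x = i then 1 else 0 := rfl

/-- The matrix units exchanging residue classes modulo `r`. -/
def blockUnit (i j : Cell r) : Calkin (Ell N p) :=
  mulClass p (cellIndicator r i) * shiftClass p (cellPoint i - cellPoint j)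

/-- The shift by the difference of the cell points i and j carries residue class j onto residue
class i; hence the shifted indicator of k restricts to class i as 1 if j = k and as 0 otherwise. -/
theorem blockUnit_mul (i j k l : Cell r) :
    blockUnit r p i j * blockUnit r p k l = if j = k then blockUnit r p i l else 0 := by
  rw [blockUnit, blockUnit, mul_assoc, ← mul_assoc (shiftClass p _), shiftClass_mul_mulClass,
    mul_assoc, shiftClass_mul, ← mul_assoc, ← map_mul]
  have h : cellIndicator r i * shift ∞ (cellPoint i - cellPoint j) (cellIndicator r k)
      = if j = k then cellIndicator r i else 0 := by
    ext x
    rw [lp.infty_coeFn_mul, Pi.mul_apply, shift_apply, cellIndicator_apply, cellIndicator_apply]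
    by_cases hx : cellRem r x = i
    · have h1 : cellRem r (x - (cellPoint i - cellPoint j)) = j := by
        rw [sub_eq_add_neg, cellRem_add_congr r (x' := cellPoint i)
          (by rw [hx, cellRem_cellPoint]), neg_sub, add_sub_cancel, cellRem_cellPoint]
      rw [h1]
      by_cases hjk : j = k <;> simp [hjk, hx, cellIndicator_apply]
    · by_cases hjk : j = k <;> simp [hjk, hx, cellIndicator_apply]
  rw [h]
  split_ifs with hjk
  · subst hjk
    rw [blockUnit, sub_add_sub_cancel]
  · rw [map_zero, zero_mul]

theorem sum_blockUnit : ∑ i, blockUnit r p i i = 1 := by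
  simp only [blockUnit, sub_self, shiftClass_zero, mul_one]
  rw [← map_sum, ← map_one (mulClass p)]
  congr 1
  ext x
  rw [lp.coeFn_sum, Finset.sum_apply]
  simp [cellIndicator_apply]

theorem blockUnit_comm (i j : Cell r) :
    ∀ s ∈ blockGenerators r p, blockUnit r p i j * s = s * blockUnit r p i j := by
  rintro _ (⟨f, hf, rfl⟩ | ⟨β, rfl⟩)
  · rw [blockUnit, mul_assoc, shiftClass_comm_mulClass p _ (mem_slowlyOscillatingAlgebra.1 hf _),
      ← mul_assoc, ← mul_assoc, mulClass_comm]
  · have h : shift ∞ (scale r β) (cellIndicator r i) = cellIndicator r i := by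
      ext x
      rw [shift_apply, cellIndicator_apply, cellIndicator_apply, sub_eq_add_neg, ← scale_neg,
        cellRem_add_scale]
    simp only [blockUnit]
    rw [← mul_assoc, shiftClass_mul_mulClass, h, mul_assoc, mul_assoc, shiftClass_mul,
      shiftClass_mul, add_comm]

variable {r}

/-- The bicommutant of the block generators. -/
abbrev BlockAlgebra (r : Fin N → ℕ) (p : ℝ≥0∞) [Fact (1 ≤ p)] :
    Subalgebra ℂ (Calkin (Ell N p)) := bicommutant (blockGenerators r p)

/-- Slowly oscillating multipliers as elements of the block algebra. -/
def blockMul (r : Fin N → ℕ) : slowlyOscillatingAlgebra N →ₐ[ℂ] BlockAlgebra r p :=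
  ((mulClass p).comp (slowlyOscillatingAlgebra N).val).codRestrict _
    fun f => subset_bicommutant _ (Or.inl ⟨f, f.2, rfl⟩)

/-- Shifts by multiples of the periods as elements of the block algebra. -/
def blockShift (r : Fin N → ℕ) (β : Lat N) : BlockAlgebra r p :=
  ⟨shiftClass p (scale r β), subset_bicommutant _ (Or.inr ⟨β, rfl⟩)⟩

omit [∀ k, NeZero (r k)] in
theorem blockShift_add (β γ : Lat N) :
    blockShift p r (β + γ) = blockShift p r β * blockShift p r γ :=
  Subtype.ext (by
    change shiftClass p _ = shiftClass p _ * shiftClass p _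
    rw [shiftClass_mul, scale_add])

omit [∀ k, NeZero (r k)] in
theorem blockShift_zero : blockShift p r 0 = 1 :=
  Subtype.ext (by
    change shiftClass p (scale r 0) = 1
    rw [show scale r 0 = 0 by ext k; simp [scale], shiftClass_zero])

omit [∀ k, NeZero (r k)] in
theorem norm_blockShift_le (β : Lat N) : ‖blockShift p r β‖ ≤ 1 := norm_shiftClass_le p _

omit [∀ k, NeZero (r k)] in
theorem norm_blockMul_le (f : slowlyOscillatingAlgebra N) :
    ‖blockMul p r f‖ ≤ ‖(f : Ell N ∞)‖ :=
  (norm_toCalkin_le _).trans (norm_mulOp_le p _)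

variable (A : Wiener N) (hA : A ∈ wienerSemiPeriodic r)

/-- The contribution of one coefficient to the block matrix of `A`. -/
def blockTerm (i j : Cell r) (α : Lat N) : BlockAlgebra r p :=
  if cellRem r (cellPoint i - α) = j then
    blockMul p r ⟨cellSample (A.coeff α) i, cellSample_mem (hA α) i⟩ *
      blockShift p r (-cellQuot r (cellPoint i - α))
  else 0

/-- The block matrix of `A`. -/
def blockMatrix : Matrix (Cell r) (Cell r) (BlockAlgebra r p) :=
  fun i j => ∑' α, blockTerm p A hA i j α

theorem norm_blockTerm_le (i j : Cell r) (α : Lat N) :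
    ‖blockTerm p A hA i j α‖ ≤ ‖A.coeff α‖ := by
  rw [blockTerm]
  split_ifs
  · refine (norm_mul_le_of_le ((norm_blockMul_le p _).trans (norm_cellSample_le _ _))
      (norm_blockShift_le p _)).trans_eq (mul_one _)
  · rw [norm_zero]; exact norm_nonneg _

theorem hasSum_blockTerm (i j : Cell r) :
    HasSum (blockTerm p A hA i j) (blockMatrix p A hA i j) := by
  have : CompleteSpace (BlockAlgebra r p) := (isClosed_bicommutant _).completeSpace_coe
  exact (Summable.of_norm_bounded A.summable_norm (norm_blockTerm_le p A hA i j)).hasSum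

/-- For x in class i the point x - α lies in a single class j, and V_α factors into a shift by a
multiple of r and the shift from j to i. On class i the coefficient agrees with its sample, which is
slowly oscillating. -/
theorem sum_blockTerm_mul (α : Lat N) :
    ∑ i, ∑ j, (blockTerm p A hA i j α : Calkin (Ell N p)) * blockUnit r p i j
      = toCalkin (mulOp p (A.coeff α) ∘L shift p α) := by
  have h1 : ∀ i, ∑ j, (blockTerm p A hA i j α : Calkin (Ell N p)) * blockUnit r p i j
      = mulClass p (cellIndicator r i * A.coeff α) * shiftClass p α := by
    intro i
    rw [Finset.sum_eq_single (cellRem r (cellPoint i - α))]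
    · rw [blockTerm, if_pos rfl]
      set x := cellPoint i - α with hx
      change mulClass p (cellSample (A.coeff α) i) * shiftClass p (scale r (-cellQuot r x)) * _ = _
      rw [blockUnit, mul_assoc, ← mul_assoc (shiftClass p _), shiftClass_mul_mulClass, mul_assoc,
        shiftClass_mul, ← mul_assoc, ← map_mul]
      congr 2
      · ext y
        rw [lp.infty_coeFn_mul, lp.infty_coeFn_mul, Pi.mul_apply, Pi.mul_apply, shift_apply,
          cellIndicator_apply, cellIndicator_apply, cellSample_apply, sub_eq_add_neg, ← scale_neg,
          cellRem_add_scale]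
        split_ifs with h
        · rw [mul_one, one_mul, ← h, add_comm, cellPoint_add_scale]
        · rw [mul_zero, zero_mul]
      -- Division with remainder of the cell point i minus α: the two shifts compose to V_α.
      · have h2 := cellPoint_add_scale r x
        rw [scale_neg, eq_sub_of_add_eq' h2, hx]
        abel
    · intro j _ hj
      rw [blockTerm, if_neg hj.symm]
      exact zero_mul _
    · simp
  simp only [h1]
  refine (Finset.sum_mul Finset.univ (fun i => mulClass p (cellIndicator r i * A.coeff α))
    (shiftClass p α)).symm.trans ?_
  rw [← map_sum, ← Finset.sum_mul]
  have h3 : ∑ i, cellIndicator r i = 1 := by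
    ext x
    rw [lp.coeFn_sum, Finset.sum_apply]
    simp [cellIndicator_apply]
  rw [h3, one_mul, shiftClass, mulClass_apply, ← map_mul]
  rfl

theorem sum_blockMatrix_mul :
    ∑ i, ∑ j, (blockMatrix p A hA i j : Calkin (Ell N p)) * blockUnit r p i j
      = toCalkin (A.toOp p) := by
  have h1 : HasSum (fun α => ∑ i, ∑ j, (blockTerm p A hA i j α : Calkin (Ell N p)) *
      blockUnit r p i j)
      (∑ i, ∑ j, (blockMatrix p A hA i j : Calkin (Ell N p)) * blockUnit r p i j) := by
    refine hasSum_sum fun i _ => hasSum_sum fun j _ => HasSum.mul_right _ ?_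
    exact (hasSum_blockTerm p A hA i j).map (BlockAlgebra r p).val.toAddMonoidHom
      continuous_subtype_val
  refine h1.unique ?_
  simp only [sum_blockTerm_mul]
  exact (A.summable_toOp p).hasSum.map (toCalkin (X := Ell N p)) continuous_toCalkin

/-- If `A - z` is not Fredholm then some character of the block algebra maps the block matrix of
`A` to a matrix with eigenvalue `z`. -/
theorem exists_character_of_not_isFredholm {z : ℂ}
    (hz : ¬ (A.toOp p - z • ContinuousLinearMap.id ℂ (Ell N p)).IsFredholm) :
    ∃ χ : BlockAlgebra r p →ₐ[ℂ] ℂ, Continuous χ ∧ (∀ y, ‖χ y‖ ≤ ‖y‖) ∧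
      z ∈ spectrum ℂ ((blockMatrix p A hA).map χ) := by
  by_contra! hcon
  refine hz (isFredholm_of_isUnit_toCalkin ?_)
  have h := isUnit_sum_mul_matrixUnits (blockGenerators_comm r p) (blockUnit r p)
    (blockUnit_mul r p) (sum_blockUnit r p) (blockUnit_comm r p)
    (blockMatrix p A hA - Matrix.scalar (Cell r) (algebraMap ℂ (BlockAlgebra r p) z)) ?_
  · have h2 : toCalkin (A.toOp p - z • ContinuousLinearMap.id ℂ (Ell N p))
        = ∑ i, ∑ j, ((blockMatrix p A hA - Matrix.scalar (Cell r)
          (algebraMap ℂ (BlockAlgebra r p) z)) i j : Calkin (Ell N p)) * blockUnit r p i j := by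
      have h3 : ∀ i, ∑ j, ((Matrix.scalar (Cell r) (algebraMap ℂ (BlockAlgebra r p) z)) i j :
          Calkin (Ell N p)) * blockUnit r p i j = z • blockUnit r p i i := by
        intro i
        rw [Finset.sum_eq_single i]
        · rw [Matrix.scalar_apply, Matrix.diagonal_apply_eq, Algebra.smul_def]
          rfl
        · intro j _ hj
          rw [Matrix.scalar_apply, Matrix.diagonal_apply_ne _ hj.symm]
          exact zero_mul _
        · simp
      have h4 : toCalkin (z • ContinuousLinearMap.id ℂ (Ell N p))
          = ∑ i, ∑ j, ((Matrix.scalar (Cell r) (algebraMap ℂ (BlockAlgebra r p) z)) i j :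
            Calkin (Ell N p)) * blockUnit r p i j := by
        simp only [h3]
        rw [← Finset.smul_sum, sum_blockUnit, map_smul]
        exact congrArg (z • ·) (map_one toCalkin)
      rw [map_sub, h4, ← sum_blockMatrix_mul p A hA]
      refine (Finset.sum_sub_distrib _ _).symm.trans (Finset.sum_congr rfl fun i _ => ?_)
      refine (Finset.sum_sub_distrib _ _).symm.trans (Finset.sum_congr rfl fun j _ => ?_)
      exact (sub_mul _ _ _).symm
    rw [h2]
    exact h
  · intro χ hχ hn hdet
    refine hcon χ hχ (fun y => (hn y).trans ?_) ?_
    -- The unit has norm at most 1, being the class of the shift by 0.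
    · refine mul_le_of_le_one_right (norm_nonneg _) ?_
      rw [← shiftClass_zero]
      exact norm_shiftClass_le p _
    · rw [spectrum.mem_iff, Matrix.isUnit_iff_isUnit_det, isUnit_iff_ne_zero, not_not]
      rw [← neg_sub, Matrix.det_neg, mul_eq_zero]
      right
      rw [← hdet]
      congr 1
      ext i j
      simp [Matrix.algebraMap_matrix_apply, Matrix.diagonal_apply, apply_ite χ]

end Blocks

/-! ### The entries of the symbol -/

section Symbol

/-- The powers of `lambdaHat n t`. -/
def lambdaPow (n : ℕ) (t : Circle) (m : ℤ) : Matrix (Fin n) (Fin n) ℂ :=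
  Matrix.of fun i j =>
    if ((i : ℕ) + m) % n = (j : ℕ) then (t : ℂ) ^ (-(((i : ℕ) + m) / (n : ℤ))) else 0

theorem lambdaPow_zero (n : ℕ) (t : Circle) : lambdaPow n t 0 = 1 := by
  ext i j
  have hi : ((i : ℕ) : ℤ) < n := by exact_mod_cast i.2
  simp only [lambdaPow, Matrix.of_apply, add_zero, Int.emod_eq_of_lt (Int.natCast_nonneg _) hi,
    Int.ediv_eq_zero_of_lt (Int.natCast_nonneg _) hi, neg_zero, zpow_zero, Matrix.one_apply,
    Nat.cast_inj, Fin.ext_iff]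

theorem lambdaPow_one (n : ℕ) (t : Circle) : lambdaPow n t 1 = lambdaHat n t := by
  ext i j
  simp only [lambdaPow, lambdaHat, Matrix.of_apply]
  have hi := i.2
  have hj := j.2
  by_cases h : (i : ℕ) + 1 = n
  · have h1 : ((i : ℕ) : ℤ) + 1 = n := by exact_mod_cast h
    have hn : (n : ℤ) ≠ 0 := by omega
    rw [h1, Int.emod_self, Int.ediv_self hn, zpow_neg_one, if_neg (by omega : ¬ (i : ℕ) + 1 = j)]
    by_cases hj0 : (j : ℕ) = 0
    · rw [if_pos (by omega), if_pos ⟨h, hj0⟩]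
    · rw [if_neg (by omega), if_neg (by omega)]
  · have h1 : ((i : ℕ) : ℤ) + 1 < n := by omega
    rw [Int.emod_eq_of_lt (by omega) h1, Int.ediv_eq_zero_of_lt (by omega) h1, neg_zero, zpow_zero]
    by_cases hj1 : (i : ℕ) + 1 = j
    · rw [if_pos (by omega), if_pos hj1]
    · rw [if_neg (by omega), if_neg hj1, if_neg (by omega)]

/-- Row i has its only nonzero entry in column (i + m) mod n, and the exponent of t counts the wraps
around the cell; these counts add under composition. -/
theorem lambdaPow_mul (n : ℕ) [NeZero n] (t : Circle) (m m' : ℤ) :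
    lambdaPow n t m * lambdaPow n t m' = lambdaPow n t (m + m') := by
  have hn : (0 : ℤ) < n := by exact_mod_cast Nat.pos_of_ne_zero (NeZero.ne n)
  ext i l
  rw [Matrix.mul_apply]
  set q : ℤ := (i : ℕ) + m with hq
  have h0 := Int.emod_nonneg q hn.ne'
  have h1 := Int.emod_lt_of_pos q hn
  let j₀ : Fin n := ⟨(q % n).toNat, by omega⟩
  have hj₀ : ((j₀ : ℕ) : ℤ) = q % n := Int.toNat_of_nonneg h0
  rw [Finset.sum_eq_single j₀]
  · simp only [lambdaPow, Matrix.of_apply]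
    rw [if_pos (by rw [hj₀, hq]), hj₀, ← hq, ← add_assoc, ← hq]
    have h2 : q % n + m' = q + m' + n * (-(q / n)) := by
      have := Int.emod_add_mul_ediv q n
      linarith
    rw [h2, Int.add_mul_emod_self_left, Int.add_mul_ediv_left _ _ hn.ne']
    split_ifs
    · rw [← zpow_add₀ (Circle.coe_ne_zero t)]
      congr 1
      ring
    · rw [mul_zero]
  · intro j _ hj
    have : ¬ (q % n = (j : ℕ)) := fun h => hj (Fin.ext (by
      have : ((j : ℕ) : ℤ) = (j₀ : ℕ) := by rw [hj₀, h]
      exact_mod_cast this))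
    simp only [lambdaPow, Matrix.of_apply]
    rw [if_neg this, zero_mul]
  · simp

theorem lambdaHat_zpow (n : ℕ) [NeZero n] (t : Circle) (m : ℤ) :
    lambdaHat n t ^ m = lambdaPow n t m := by
  have hdet : IsUnit (lambdaHat n t).det := by
    refine Matrix.isUnit_det_of_right_inverse (B := lambdaPow n t (-1)) ?_
    rw [← lambdaPow_one, lambdaPow_mul, add_neg_cancel, lambdaPow_zero]
  have hinv : (lambdaHat n t)⁻¹ = lambdaPow n t (-1) := by
    refine Matrix.inv_eq_right_inv ?_
    rw [← lambdaPow_one, lambdaPow_mul, add_neg_cancel, lambdaPow_zero]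
  induction m using Int.induction_on with
  | zero => rw [zpow_zero, lambdaPow_zero]
  | succ k ih => rw [Matrix.zpow_add_one hdet, ih, ← lambdaPow_one, lambdaPow_mul]
  | pred k ih => rw [Matrix.zpow_sub_one hdet, ih, hinv, lambdaPow_mul, sub_eq_add_neg]

/-- The character `β ↦ ∏ t_k^{-β_k}` of the lattice. -/
def latticeChar (t : Fin N → Circle) (β : Lat N) : ℂ := ∏ k, (t k : ℂ) ^ (-β k)

theorem norm_latticeChar (t : Fin N → Circle) (β : Lat N) : ‖latticeChar t β‖ = 1 := by
  rw [latticeChar, norm_prod]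
  exact Finset.prod_eq_one fun k _ => by rw [norm_zpow, Circle.norm_coe, one_zpow]

theorem latticeChar_add (t : Fin N → Circle) (β γ : Lat N) :
    latticeChar t (β + γ) = latticeChar t β * latticeChar t γ := by
  rw [latticeChar, latticeChar, latticeChar, ← Finset.prod_mul_distrib]
  refine Finset.prod_congr rfl fun k _ => ?_
  rw [← zpow_add₀ (Circle.coe_ne_zero (t k)), Pi.add_apply, neg_add]

variable {r : Fin N → ℕ} [∀ k, NeZero (r k)]

/-- This gives the symbol the same shape as `blockTerm`, with `latticeChar` in place of the shifts
by multiples of r. -/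
theorem tensorMatrix_lambdaHat_apply (t : Fin N → Circle) (α : Lat N) (i j : Cell r) :
    tensorMatrix (fun k => lambdaHat (r k) (t k) ^ (-α k)) i j =
      if cellRem r (cellPoint i - α) = j then latticeChar t (cellQuot r (cellPoint i - α))
      else 0 := by
  have h1 : ∀ k, (lambdaHat (r k) (t k) ^ (-α k)) (i k) (j k) =
      if cellRem r (cellPoint i - α) k = j k then
        (t k : ℂ) ^ (-(cellQuot r (cellPoint i - α) k)) else 0 := by
    intro k
    rw [lambdaHat_zpow, lambdaPow, Matrix.of_apply]
    have h2 : ((i k : ℕ) : ℤ) + -α k = (cellPoint i - α) k := by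
      rw [Pi.sub_apply, sub_eq_add_neg]; rfl
    rw [h2, ← cellPoint_cellRem_apply r]
    have h3 : (cellPoint (cellRem r (cellPoint i - α)) k = ((j k : ℕ) : ℤ)) ↔
        cellRem r (cellPoint i - α) k = j k := by
      rw [Fin.ext_iff, cellPoint, Nat.cast_inj]
    simp only [h3]
    rfl
  rw [tensorMatrix, Matrix.of_apply]
  have h4 : (∀ k ∈ Finset.univ, cellRem r (cellPoint i - α) k = j k) ↔
      cellRem r (cellPoint i - α) = j := by simp [funext_iff]
  simp only [h1, Finset.prod_ite_zero, h4]
  rfl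

theorem hasSum_symbol (B : Wiener N) (t : Fin N → Circle) (i j : Cell r) :
    HasSum (fun α => B.coeff α (cellPoint i) *
      if cellRem r (cellPoint i - α) = j then latticeChar t (cellQuot r (cellPoint i - α)) else 0)
      (B.symbol r t i j) := by
  have hterm : ∀ (i j : Cell r) α, (cellDiag r (B.coeff α) *
      tensorMatrix fun k => lambdaHat (r k) (t k) ^ (-α k)) i j = B.coeff α (cellPoint i) *
      if cellRem r (cellPoint i - α) = j then latticeChar t (cellQuot r (cellPoint i - α))
      else 0 := by
    intro i j α
    rw [cellDiag, Matrix.diagonal_mul, tensorMatrix_lambdaHat_apply]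
    rfl
  have hs : Summable fun α => cellDiag r (B.coeff α) *
      tensorMatrix fun k => lambdaHat (r k) (t k) ^ (-α k) := by
    refine Pi.summable.2 fun i => Pi.summable.2 fun j => ?_
    refine Summable.of_norm_bounded B.summable_norm fun α => ?_
    rw [hterm, norm_mul]
    refine (mul_le_mul (lp.norm_apply_le_norm ENNReal.top_ne_zero _ _) ?_ (norm_nonneg _)
      (norm_nonneg _)).trans_eq (mul_one _)
    split_ifs
    · exact (norm_latticeChar _ _).le
    · simp
  have h2 := Pi.hasSum.1 (Pi.hasSum.1 hs.hasSum i) j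
  exact h2.congr_fun (fun α => (hterm i j α).symm)

end Symbol

/-! ### Characters of the block algebra are symbols of limit operators -/

section CharacterSymbol

variable {r : Fin N → ℕ} [∀ k, NeZero (r k)] (p : ℝ≥0∞) [Fact (1 ≤ p)]

omit [∀ k, NeZero (r k)] in
-- t_k is the value of χ at the shift by r_k e_k. It is unimodular since χ is contractive on a shift
-- and on its inverse.
theorem exists_circle_character (χ : BlockAlgebra r p →ₐ[ℂ] ℂ) (hχ : ∀ y, ‖χ y‖ ≤ ‖y‖) :
    ∃ t : Fin N → Circle, ∀ β, χ (blockShift p r (-β)) = latticeChar t β := by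
  let φ : Multiplicative (Lat N) →* ℂ :=
    { toFun := fun β => χ (blockShift p r β.toAdd)
      map_one' := by
        change χ (blockShift p r 0) = 1
        rw [blockShift_zero, map_one]
      map_mul' := fun β γ => by
        rw [toAdd_mul, blockShift_add, map_mul] }
  have hle : ∀ β, ‖φ β‖ ≤ 1 := fun β => (hχ _).trans (norm_blockShift_le p _)
  have hne : ∀ β, ‖φ β‖ = 1 := by
    intro β
    have h1 : φ β * φ β⁻¹ = 1 := by rw [← map_mul, mul_inv_cancel, map_one]
    have h2 : ‖φ β‖ * ‖φ β⁻¹‖ = 1 := by rw [← norm_mul, h1, norm_one]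
    nlinarith [hle β, hle β⁻¹, norm_nonneg (φ β), norm_nonneg (φ β⁻¹)]
  refine ⟨fun k => ⟨φ (Multiplicative.ofAdd (Pi.single k 1)),
    mem_sphere_zero_iff_norm.2 (hne _)⟩, fun β => ?_⟩
  have h3 : (-β : Lat N) = ∑ k, (-β k) • (Pi.single k 1 : Lat N) := by
    ext l
    simp [Finset.sum_apply, Pi.single_apply]
  have h4 : Multiplicative.ofAdd (-β) =
      ∏ k, (Multiplicative.ofAdd (Pi.single k 1 : Lat N)) ^ (-β k) := by
    rw [h3]
    exact ofAdd_sum _ _ |>.trans (Finset.prod_congr rfl fun k _ => ofAdd_zsmul _ _)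
  have h5 : ((φ.toHomUnits (Multiplicative.ofAdd (-β)) : ℂˣ) : ℂ) =
      ∏ k, ((φ.toHomUnits (Multiplicative.ofAdd (Pi.single k 1 : Lat N)) : ℂˣ) : ℂ) ^ (-β k) := by
    rw [h4, map_prod, Units.coe_prod]
    refine Finset.prod_congr rfl fun k _ => ?_
    rw [map_zpow, Units.val_zpow_eq_zpow_val]
  exact h5

/-- The pairs (α, i) are countable, so one sequence y computes χ on all samples of all coefficients.
The values of χ there become the coefficients of B. -/
theorem exists_coeffLimit_symbol_eq (A : Wiener N) (hA : A ∈ wienerSemiPeriodic r)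
    (χ : BlockAlgebra r p →ₐ[ℂ] ℂ) (hc : Continuous χ) (hχ : ∀ y, ‖χ y‖ ≤ ‖y‖) :
    ∃ (B : Wiener N) (h : ℕ → Lat N) (t : Fin N → Circle), Tendsto h atTop cofinite ∧
      CoeffLimit A h B ∧ B.symbol r t = (blockMatrix p A hA).map χ := by
  obtain ⟨t, ht⟩ := exists_circle_character p χ hχ
  let ψ : slowlyOscillatingAlgebra N →ₐ[ℂ] ℂ := χ.comp (blockMul p r)
  let f : Lat N × Cell r → slowlyOscillatingAlgebra N := fun m =>
    ⟨cellSample (A.coeff m.1) m.2, cellSample_mem (hA m.1) m.2⟩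
  obtain ⟨y, hy, hyf⟩ := exists_seq_tendsto_character ψ (fun g hg => by
    have : blockMul p r g = 0 := Subtype.ext (mulClass_eq_zero p hg)
    change χ (blockMul p r g) = 0
    rw [this, map_zero]) f
  have hψn : ∀ g, ‖ψ g‖ ≤ ‖(g : Ell N ∞)‖ := fun g => (hχ _).trans (norm_blockMul_le p g)
  let b : Lat N → Lat N → ℂ := fun α x => ψ (f (α, cellRem r x))
  have hb : ∀ α x, ‖b α x‖ ≤ ‖A.coeff α‖ := fun α x =>
    (hψn _).trans (norm_cellSample_le _ _)
  let B : Wiener N := ⟨fun α => ⟨b α, memℓp_infty ⟨‖A.coeff α‖, by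
      rintro _ ⟨x, rfl⟩; exact hb α x⟩⟩,
    Summable.of_nonneg_of_le (fun _ => norm_nonneg _)
      (fun α => lp.norm_le_of_forall_le (norm_nonneg _) (hb α)) A.summable_norm⟩
  -- The corner of the cell of y_n: the sample at y_n is a_α at h_n plus the cell point.
  let h : ℕ → Lat N := fun n => scale r (cellQuot r (y n))
  have hh : Tendsto h atTop cofinite := by
    have := (tendsto_scale_cellQuot r 0).comp hy
    simp only [add_zero] at this
    exact this
  refine ⟨B, h, t, hh, fun α x => ?_, ?_⟩
  · set i := cellRem r x with hi
    have h1 : Tendsto (fun n => A.coeff α (h n + cellPoint i)) atTop (𝓝 (b α x)) := hyf (α, i)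
    -- Convergence is known at the points of the cell; asymptotic periodicity carries it to every x.
    have h2 := scale_mem_asymPeriods (hA α) (cellQuot r x)
    have h3 := (Tendsto.comp h2 ((tendsto_add_cofinite (cellPoint i)).comp hh)).add h1
    rw [zero_add] at h3
    refine h3.congr fun n => ?_
    simp only [Function.comp_apply]
    rw [sub_add_cancel, add_assoc, cellPoint_add_scale, add_comm]
  · ext i j
    rw [Matrix.map_apply]
    refine (hasSum_symbol B t i j).unique ?_
    have h1 := (hasSum_blockTerm p A hA i j).map χ hc
    refine h1.congr_fun (fun α => ?_)
    simp only [Function.comp_apply, blockTerm]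
    split_ifs
    · rw [map_mul, ht]
      congr 1
      change ψ (f (α, cellRem r (cellPoint i))) = _
      rw [cellRem_cellPoint]
      rfl
    · rw [mul_zero, map_zero]

/-- If `A - z` is not Fredholm, then `z` is an eigenvalue of the symbol of a limit operator. -/
theorem exists_limitOp_of_not_isFredholm (A : Wiener N) (hA : A ∈ wienerSemiPeriodic r) {z : ℂ}
    (hz : z ∈ essSpectrum (A.toOp p)) {q : ℝ≥0∞} [Fact (1 ≤ q)] (hq1 : 1 < q) (hq : q ≠ ∞) :
    ∃ B : Wiener N, B.toOp q ∈ opSpectrum (A.toOp q) ∧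
      ∃ t : Fin N → Circle, z ∈ spectrum ℂ (B.symbol r t) := by
  obtain ⟨χ, hc, hχ, hsp⟩ := exists_character_of_not_isFredholm p A hA hz
  obtain ⟨B, h, t, hh, hB, hs⟩ := exists_coeffLimit_symbol_eq p A hA χ hc hχ
  exact ⟨B, ⟨h, hh, hB.isLimitOp hq1 hq⟩, t, by rwa [hs]⟩

end CharacterSymbol

/-! ### Exponentially decaying weights -/

section Weight

/-- The `l^1`-norm of a lattice point. -/
def latNorm (x : Lat N) : ℝ := ∑ k, |(x k : ℝ)|

theorem latNorm_nonneg (x : Lat N) : 0 ≤ latNorm x := Finset.sum_nonneg fun _ _ => abs_nonneg _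

theorem latNorm_sub_le (x y : Lat N) : latNorm (x - y) ≤ latNorm x + latNorm y := by
  rw [latNorm, latNorm, latNorm, ← Finset.sum_add_distrib]
  refine Finset.sum_le_sum fun k _ => ?_
  rw [Pi.sub_apply, Int.cast_sub]
  exact abs_sub _ _

theorem latNorm_le_sub_add (x y : Lat N) : latNorm x ≤ latNorm (x - y) + latNorm y := by
  rw [latNorm, latNorm, latNorm, ← Finset.sum_add_distrib]
  refine Finset.sum_le_sum fun k _ => ?_
  rw [Pi.sub_apply, Int.cast_sub]
  calc |(x k : ℝ)| = |((x k : ℝ) - y k) + y k| := by rw [sub_add_cancel]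
    _ ≤ _ := abs_add_le _ _

theorem summable_exp_neg_abs {ε : ℝ} (hε : 0 < ε) :
    Summable fun n : ℤ => Real.exp (-(ε * |(n : ℝ)|)) := by
  have h : Summable fun n : ℕ => Real.exp (-(ε * n)) := by
    have := Real.summable_exp_nat_mul_iff.2 (neg_lt_zero.2 hε)
    refine this.congr fun n => ?_
    congr 1
    ring
  refine Summable.of_nat_of_neg ?_ ?_
  · simpa using h
  · simpa using h

theorem subset_piFinset_image (u : Finset (Lat N)) :
    u ⊆ Fintype.piFinset fun k => u.image fun x => x k := fun _ hx =>
  Fintype.mem_piFinset.2 fun k => Finset.mem_image_of_mem (fun x => x k) hx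

theorem sum_prod_apply_le {g : ℤ → ℝ} (hg0 : ∀ n, 0 ≤ g n) (s : Fin N → Finset ℤ)
    {u : Finset (Lat N)} (hu : u ⊆ Fintype.piFinset s) :
    ∑ x ∈ u, ∏ k, g (x k) ≤ ∏ k, ∑ n ∈ s k, g n := by
  rw [Finset.prod_univ_sum]
  exact Finset.sum_le_sum_of_subset_of_nonneg hu fun x _ _ =>
    Finset.prod_nonneg fun _ _ => hg0 _

theorem summable_prod_apply {g : ℤ → ℝ} (hg0 : ∀ n, 0 ≤ g n) (hg : Summable g) :
    Summable fun x : Lat N => ∏ k, g (x k) :=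
  summable_of_sum_le (c := ∏ _k : Fin N, ∑' n, g n)
    (fun _ => Finset.prod_nonneg fun _ _ => hg0 _) fun u =>
    (sum_prod_apply_le hg0 _ (subset_piFinset_image u)).trans
      (Finset.prod_le_prod (fun _ _ => Finset.sum_nonneg fun _ _ => hg0 _)
        fun _ _ => hg.sum_le_tsum _ fun _ _ => hg0 _)

theorem summable_exp_neg_latNorm {ε : ℝ} (hε : 0 < ε) :
    Summable fun x : Lat N => Real.exp (-(ε * latNorm x)) := by
  refine (summable_prod_apply (fun _ => (Real.exp_pos _).le) (summable_exp_neg_abs hε)).congr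
    fun x => ?_
  rw [← Real.exp_sum, latNorm, Finset.mul_sum, Finset.sum_neg_distrib]

theorem memℓp_of_summable_norm (p : ℝ≥0∞) [Fact (1 ≤ p)] {f : Lat N → ℂ}
    (hf : Summable fun x => ‖f x‖) : Memℓp f p := by
  have h1 : Memℓp f 1 := memℓp_gen (by simpa using hf)
  exact h1.of_exponent_ge Fact.out

/-- The series converges absolutely, also for p = ∞, where a general element is not the sum of its
delta components. -/
theorem hasSum_single_of_summable_norm (p : ℝ≥0∞) [Fact (1 ≤ p)] (u : Ell N p)
    (hu : Summable fun x => ‖u x‖) : HasSum (fun x => (lp.single p x (u x) : Ell N p)) u := by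
  have hs : Summable fun x => (lp.single p x (u x) : Ell N p) := by
    refine Summable.of_norm ?_
    simpa only [lp.norm_single (pos_iff_ne_zero.2 (exponent_ne_zero p))] using hu
  convert hs.hasSum
  ext x
  have h1 := hs.hasSum.mapL (lp.evalCLM ℂ (fun _ : Lat N => ℂ) p x)
  refine HasSum.unique ?_ h1
  have h2 : u x = (lp.single p x (u x) : Ell N p) x := 
    (lp.single_apply_self (E := fun _ : Lat N => ℂ) p x (u x)).symm
  conv => arg 2; rw [h2]
  refine hasSum_single x fun y hy => ?_
  exact lp.single_apply_ne p y _ hy.symm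

/-- The weight `exp (-ε |x|)`. -/
def expWeight (p : ℝ≥0∞) [Fact (1 ≤ p)] {ε : ℝ} (hε : 0 < ε) : Ell N p :=
  ⟨fun x => ((Real.exp (-(ε * latNorm x)) : ℝ) : ℂ), memℓp_of_summable_norm p (by
    simpa only [Complex.norm_real, Real.norm_of_nonneg (Real.exp_pos _).le] using
      summable_exp_neg_latNorm hε)⟩

variable (p : ℝ≥0∞) [Fact (1 ≤ p)] {ε : ℝ} (hε : 0 < ε)

theorem expWeight_apply (x : Lat N) :
    expWeight p hε x = ((Real.exp (-(ε * latNorm x)) : ℝ) : ℂ) := rfl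

theorem norm_expWeight_apply (x : Lat N) :
    ‖expWeight p hε x‖ = Real.exp (-(ε * latNorm x)) := by
  rw [expWeight_apply, Complex.norm_real, Real.norm_of_nonneg (Real.exp_pos _).le]

theorem norm_expWeight_pos : 0 < ‖(expWeight p hε : Ell N p)‖ := by
  refine lt_of_lt_of_le ?_ (lp.norm_apply_le_norm (exponent_ne_zero p) _ (0 : Lat N))
  rw [norm_expWeight_apply]
  exact Real.exp_pos _

theorem norm_le_mul_of_apply_le {u v : Ell N p} {C : ℝ} (hC : 0 ≤ C)
    (h : ∀ x, ‖u x‖ ≤ C * ‖v x‖) : ‖u‖ ≤ C * ‖v‖ := by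
  have h1 : ‖u‖ ≤ ‖((C : ℝ) : ℂ) • v‖ := lp.norm_mono (exponent_ne_zero p) fun x => by
    rw [lp.coeFn_smul, Pi.smul_apply, norm_smul, Complex.norm_real, Real.norm_of_nonneg hC]
    exact h x
  rwa [norm_smul, Complex.norm_real, Real.norm_of_nonneg hC] at h1

/-- The exponential bound tends to 0 with ε for fixed α. The bound 2 provides a summable majorant
without any decay of the coefficients beyond summability. -/
theorem norm_shift_expWeight_sub_le (α : Lat N) :
    ‖shift p α (expWeight p hε) - expWeight p hε‖
      ≤ min 2 (Real.exp (ε * latNorm α) - 1) * ‖(expWeight p hε : Ell N p)‖ := by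
  have h2 : ‖shift p α (expWeight p hε) - expWeight p hε‖ ≤ 2 * ‖(expWeight p hε : Ell N p)‖ := by
    refine (norm_sub_le _ _).trans ?_
    rw [norm_shift_apply, two_mul]
  have hn : 0 ≤ ε * latNorm α := mul_nonneg hε.le (latNorm_nonneg α)
  have h3 : ‖shift p α (expWeight p hε) - expWeight p hε‖
      ≤ (Real.exp (ε * latNorm α) - 1) * ‖(expWeight p hε : Ell N p)‖ := by
    refine norm_le_mul_of_apply_le p (by linarith [Real.one_le_exp hn]) fun x => ?_
    rw [lp.coeFn_sub, Pi.sub_apply, shift_apply, expWeight_apply, expWeight_apply,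
      ← Complex.ofReal_sub, Complex.norm_real, Complex.norm_real,
      Real.norm_of_nonneg (Real.exp_pos _).le, Real.norm_eq_abs, abs_le]
    have e1 : Real.exp (-(ε * latNorm (x - α)))
        ≤ Real.exp (ε * latNorm α) * Real.exp (-(ε * latNorm x)) := by
      rw [← Real.exp_add, Real.exp_le_exp]
      nlinarith [latNorm_le_sub_add x α]
    have e2 : Real.exp (-(ε * latNorm α)) * Real.exp (-(ε * latNorm x))
        ≤ Real.exp (-(ε * latNorm (x - α))) := by
      rw [← Real.exp_add, Real.exp_le_exp]
      nlinarith [latNorm_sub_le x α]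
    -- This turns the lower bound 1 - e^{-s} into the upper bound e^s - 1.
    have e3 : 2 ≤ Real.exp (ε * latNorm α) + Real.exp (-(ε * latNorm α)) := by
      have := Real.add_one_le_exp (ε * latNorm α)
      have := Real.add_one_le_exp (-(ε * latNorm α))
      linarith
    have e4 := Real.exp_pos (-(ε * latNorm x))
    constructor
    · nlinarith
    · linarith
  rcases min_choice 2 (Real.exp (ε * latNorm α) - 1) with h | h <;> rw [h]
  · exact h2
  · exact h3

theorem tendsto_tsum_min_exp {b : Lat N → ℝ} (hb0 : ∀ α, 0 ≤ b α) (hb : Summable b) :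
    Tendsto (fun ε : ℝ => ∑' α, b α * min 2 (Real.exp (ε * latNorm α) - 1)) (𝓝[>] 0) (𝓝 0) := by
  have hz : 𝓝 (0 : ℝ) = 𝓝 (∑' _ : Lat N, (0 : ℝ)) := by rw [tsum_zero]
  rw [hz]
  refine tendsto_tsum_of_dominated_convergence (hb.mul_right 2) (fun α => ?_) ?_
  · have h1 : Tendsto (fun ε : ℝ => b α * min 2 (Real.exp (ε * latNorm α) - 1)) (𝓝 0)
        (𝓝 (b α * min 2 (Real.exp (0 * latNorm α) - 1))) := by
      have : Continuous fun ε : ℝ => b α * min 2 (Real.exp (ε * latNorm α) - 1) := by fun_prop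
      exact this.tendsto 0
    rw [zero_mul, Real.exp_zero, sub_self, min_eq_right zero_le_two, mul_zero] at h1
    exact h1.mono_left nhdsWithin_le_nhds
  · filter_upwards [self_mem_nhdsWithin] with ε hε α
    have h0 : 0 ≤ min 2 (Real.exp (ε * latNorm α) - 1) :=
      le_min zero_le_two (by
        linarith [Real.one_le_exp (mul_nonneg (le_of_lt hε) (latNorm_nonneg α))])
    rw [Real.norm_of_nonneg (mul_nonneg (hb0 α) h0)]
    exact mul_le_mul_of_nonneg_left (min_le_left _ _) (hb0 α)

end Weight

/-! ### Approximate eigenvectors of periodic operators -/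

section Periodic

variable {r : Fin N → ℕ} [∀ k, NeZero (r k)]

/-- The quasi-periodic extension of a function on the periodicity cell. -/
def quasiPeriodic (t : Fin N → Circle) (c : Cell r → ℂ) : Ell N ∞ :=
  ⟨fun x => latticeChar t (cellQuot r x) * c (cellRem r x), memℓp_infty ⟨‖c‖, by
    rintro _ ⟨x, rfl⟩
    dsimp only
    rw [norm_mul, norm_latticeChar, one_mul]
    exact norm_le_pi_norm c _⟩⟩

theorem quasiPeriodic_apply (t : Fin N → Circle) (c : Cell r → ℂ) (x : Lat N) :
    quasiPeriodic t c x = latticeChar t (cellQuot r x) * c (cellRem r x) := rfl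

theorem quasiPeriodic_add_scale (t : Fin N → Circle) (c : Cell r → ℂ) (x β : Lat N) :
    quasiPeriodic t c (x + scale r β) = latticeChar t β * quasiPeriodic t c x := by
  rw [quasiPeriodic_apply, quasiPeriodic_apply, cellQuot_add_scale, cellRem_add_scale,
    latticeChar_add]
  ring

/-- At the points of the cell this is the eigenvector equation of the symbol; periodicity of the
coefficients and quasi-periodicity of the extension spread it over the lattice. -/
theorem hasSum_quasiPeriodic {B : Wiener N} (hB : B ∈ wienerPeriodic r) (t : Fin N → Circle)
    (c : Cell r → ℂ) {z : ℂ} (hc : (B.symbol r t).mulVec c = z • c) (x : Lat N) :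
    HasSum (fun α => B.coeff α x * quasiPeriodic t c (x - α)) (z * quasiPeriodic t c x) := by
  set i := cellRem r x with hi
  have h1 : HasSum (fun α => B.coeff α (cellPoint i) * quasiPeriodic t c (cellPoint i - α))
      (z * c i) := by
    have h2 : HasSum (fun α => ∑ j, (B.coeff α (cellPoint i) *
        if cellRem r (cellPoint i - α) = j then latticeChar t (cellQuot r (cellPoint i - α))
        else 0) * c j) (∑ j, B.symbol r t i j * c j) :=
      hasSum_sum fun j _ => (hasSum_symbol B t i j).mul_right (c j)
    have h3 : ∑ j, B.symbol r t i j * c j = z * c i := congr_fun hc i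
    rw [h3] at h2
    refine h2.congr_fun (fun α => ?_)
    rw [Finset.sum_eq_single (cellRem r (cellPoint i - α))]
    · rw [if_pos rfl, quasiPeriodic_apply, mul_assoc]
    · intro j _ hj
      rw [if_neg hj.symm, mul_zero, zero_mul]
    · simp
  have h4 := h1.mul_left (latticeChar t (cellQuot r x))
  have h5 : latticeChar t (cellQuot r x) * (z * c i) = z * quasiPeriodic t c x := by
    rw [quasiPeriodic_apply]; ring
  rw [h5] at h4
  refine h4.congr_fun (fun α => ?_)
  have h6 : x - α = (cellPoint i - α) + scale r (cellQuot r x) := by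
    conv_lhs => rw [← cellPoint_add_scale r x]
    abel
  rw [h6, quasiPeriodic_add_scale, periodic_eq_cellRem (hB α) x]
  ring

variable (p : ℝ≥0∞) [Fact (1 ≤ p)]

/-- Since the quasi-periodic factor solves the equation exactly, only the differences Φ(x - α) -
Φ(x) of the weight remain. -/
theorem norm_toOp_sub_smul_le {B : Wiener N} (hB : B ∈ wienerPeriodic r) (t : Fin N → Circle)
    (c : Cell r → ℂ) {z : ℂ} (hc : (B.symbol r t).mulVec c = z • c) {ε : ℝ} (hε : 0 < ε) :
    ‖B.toOp p (mulOp p (quasiPeriodic t c) (expWeight p hε)) -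
        z • mulOp p (quasiPeriodic t c) (expWeight p hε)‖
      ≤ (∑' α, ‖B.coeff α‖ * min 2 (Real.exp (ε * latNorm α) - 1)) *
        (‖quasiPeriodic t c‖ * ‖(expWeight p hε : Ell N p)‖) := by
  set V := quasiPeriodic t c
  set Φ : Ell N p := expWeight p hε
  let g : Lat N → Ell N p := fun α =>
    mulOp p (B.coeff α) (mulOp p (shift ∞ α V) (shift p α Φ - Φ))
  have hg : ∀ α, ‖g α‖ ≤ (‖B.coeff α‖ * min 2 (Real.exp (ε * latNorm α) - 1)) *
      (‖V‖ * ‖Φ‖) := by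
    intro α
    calc ‖g α‖ ≤ ‖B.coeff α‖ * (‖shift ∞ α V‖ *
          (min 2 (Real.exp (ε * latNorm α) - 1) * ‖Φ‖)) := by
          refine ((mulOp p (B.coeff α)).le_of_opNorm_le (norm_mulOp_le p _) _).trans ?_
          gcongr
          refine ((mulOp p (shift ∞ α V)).le_of_opNorm_le (norm_mulOp_le p _) _).trans ?_
          gcongr
          exact norm_shift_expWeight_sub_le p hε α
      _ = _ := by rw [norm_shift_apply]; ring
  have h0 : ∀ α : Lat N, 0 ≤ min 2 (Real.exp (ε * latNorm α) - 1) := fun α =>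
    le_min zero_le_two (by linarith [Real.one_le_exp (mul_nonneg hε.le (latNorm_nonneg α))])
  have hsum : Summable fun α => ‖B.coeff α‖ * min 2 (Real.exp (ε * latNorm α) - 1) :=
    Summable.of_nonneg_of_le (fun α => mul_nonneg (norm_nonneg _) (h0 α))
      (fun α => mul_le_mul_of_nonneg_left (min_le_left _ _) (norm_nonneg _))
      (B.summable_norm.mul_right 2)
  have hgs : Summable g := Summable.of_norm_bounded (hsum.mul_right _) hg
  have heq : B.toOp p (mulOp p V Φ) - z • mulOp p V Φ = ∑' α, g α := by
    ext x
    have h1 := (B.hasSum_toOp_apply p (mulOp p V Φ) x).sub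
      ((hasSum_quasiPeriodic hB t c hc x).mul_right (Φ x))
    have h2 := hgs.hasSum.mapL (lp.evalCLM ℂ (fun _ : Lat N => ℂ) p x)
    have h3 : (B.toOp p (mulOp p V Φ) - z • mulOp p V Φ) x
        = B.toOp p (mulOp p V Φ) x - z * V x * Φ x := by
      rw [lp.coeFn_sub, Pi.sub_apply, lp.coeFn_smul, Pi.smul_apply, mulOp_apply, smul_eq_mul,
        mul_assoc]
    rw [h3]
    refine h1.unique (h2.congr_fun fun α => ?_)
    change _ = B.coeff α x * (V (x - α) * (Φ (x - α) - Φ x))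
    rw [mulOp_apply]
    ring
  rw [heq, ← tsum_mul_right]
  exact tsum_of_norm_bounded (hsum.mul_right _).hasSum hg

/-- Needed because c may vanish at some residues. The weight at any point is at most a constant
times the weight at the point of residue i₀ in the same cell; ε ≤ 1 makes the constant independent
of ε. -/
theorem exists_norm_expWeight_le (t : Fin N → Circle) {c : Cell r → ℂ} (hc : c ≠ 0) :
    ∃ K : ℝ, 0 < K ∧ ∀ (ε : ℝ) (hε : 0 < ε), ε ≤ 1 →
      ‖(expWeight p hε : Ell N p)‖ ≤ K * ‖mulOp p (quasiPeriodic t c) (expWeight p hε)‖ := by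
  obtain ⟨i₀, hi₀⟩ := Function.ne_iff.1 hc
  have hi₀ : 0 < ‖c i₀‖ := norm_pos_iff.2 hi₀
  let M : Cell r → ℝ := fun j => Real.exp (latNorm (cellPoint i₀ - cellPoint j)) / ‖c i₀‖
  have hM : ∀ j, 0 < M j := fun j => div_pos (Real.exp_pos _) hi₀
  have : Nonempty (Cell r) := ⟨i₀⟩
  refine ⟨∑ j, M j, Finset.sum_pos (fun j _ => hM j) Finset.univ_nonempty, fun ε hε hε1 => ?_⟩
  set Φ : Ell N p := expWeight p hε
  set w := mulOp p (quasiPeriodic t c) Φ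
  have h1 : Φ = ∑ j, mulOp p (cellIndicator r j) Φ := by
    ext x
    rw [lp.coeFn_sum, Finset.sum_apply]
    simp [cellIndicator_apply]
  have h2 : ∀ j, ‖mulOp p (cellIndicator r j) Φ‖ ≤ M j * ‖w‖ := by
    intro j
    rw [← norm_shift_apply p (cellPoint j - cellPoint i₀) w]
    refine norm_le_mul_of_apply_le p (hM j).le fun x => ?_
    rw [mulOp_apply, cellIndicator_apply, shift_apply]
    split_ifs with hx
    · set y := x - (cellPoint j - cellPoint i₀) with hy
      have hy' : y = cellPoint i₀ + scale r (cellQuot r x) := by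
        have := cellPoint_add_scale r x
        rw [hx] at this
        rw [hy]
        conv_lhs => rw [← this]
        abel
      have hV : ‖quasiPeriodic t c y‖ = ‖c i₀‖ := by
        rw [quasiPeriodic_apply, norm_mul, norm_latticeChar, one_mul, hy', cellRem_add_scale,
          cellRem_cellPoint]
      rw [mulOp_apply, norm_mul, norm_mul, hV, norm_one, one_mul, norm_expWeight_apply,
        norm_expWeight_apply, ← mul_assoc, div_mul_cancel₀ _ hi₀.ne', ← Real.exp_add,
        Real.exp_le_exp]
      have h3 : latNorm y ≤ latNorm x + latNorm (cellPoint i₀ - cellPoint j) := by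
        have := latNorm_le_sub_add y (cellPoint i₀ - cellPoint j)
        rwa [show y - (cellPoint i₀ - cellPoint j) = x by rw [hy]; abel] at this
      nlinarith [latNorm_nonneg (cellPoint i₀ - cellPoint j)]
    · rw [zero_mul, norm_zero]
      exact mul_nonneg (hM j).le (norm_nonneg _)
  calc ‖Φ‖ = ‖∑ j, mulOp p (cellIndicator r j) Φ‖ := by rw [← h1]
    _ ≤ ∑ j, ‖mulOp p (cellIndicator r j) Φ‖ := norm_sum_le _ _
    _ ≤ ∑ j, M j * ‖w‖ := Finset.sum_le_sum fun j _ => h2 j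
    _ = (∑ j, M j) * ‖w‖ := by rw [Finset.sum_mul]

/-- Eigenvalues of the symbol of a periodic operator are approximate eigenvalues on `l^p`, with
approximate eigenvectors in `l^1`. -/
theorem exists_approximate_eigenvector {B : Wiener N} (hB : B ∈ wienerPeriodic r)
    (t : Fin N → Circle) {z : ℂ} (hz : z ∈ spectrum ℂ (B.symbol r t)) {η : ℝ} (hη : 0 < η) :
    ∃ u : Ell N p, ‖u‖ = 1 ∧ (Summable fun x => ‖u x‖) ∧ ‖B.toOp p u - z • u‖ ≤ η := by
  obtain ⟨c, hc0, hc⟩ : ∃ c : Cell r → ℂ, c ≠ 0 ∧ (B.symbol r t).mulVec c = z • c := by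
    rw [spectrum.mem_iff, Matrix.isUnit_iff_isUnit_det, isUnit_iff_ne_zero, not_not,
      ← Matrix.exists_mulVec_eq_zero_iff] at hz
    obtain ⟨c, hc0, hc⟩ := hz
    refine ⟨c, hc0, ?_⟩
    rw [Matrix.sub_mulVec, sub_eq_zero, Algebra.algebraMap_eq_smul_one, Matrix.smul_mulVec,
      Matrix.one_mulVec] at hc
    exact hc.symm
  obtain ⟨K, hK, hKle⟩ := exists_norm_expWeight_le p t hc0
  -- The error relative to ‖w‖ is at most this product, and ε is taken so small that it is below η.
  have h1 := ((tendsto_tsum_min_exp (fun α => norm_nonneg (B.coeff α)) B.summable_norm).mul_const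
    (‖quasiPeriodic t c‖ * K))
  rw [zero_mul] at h1
  obtain ⟨ε, h2, hε0, hε1⟩ := ((h1.eventually (gt_mem_nhds hη)).and
    (Ioo_mem_nhdsGT (zero_lt_one' ℝ))).exists
  set Φ : Ell N p := expWeight p hε0
  set w := mulOp p (quasiPeriodic t c) Φ with hw
  have hΦw := hKle ε hε0 hε1.le
  have hwpos : 0 < ‖w‖ := by
    have := (norm_expWeight_pos p hε0).trans_le hΦw
    exact pos_of_mul_pos_right this hK.le
  have hbound : ‖B.toOp p w - z • w‖ ≤ η * ‖w‖ := by
    refine (norm_toOp_sub_smul_le p hB t c hc hε0).trans ?_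
    have h0 : 0 ≤ ∑' α, ‖B.coeff α‖ * min 2 (Real.exp (ε * latNorm α) - 1) :=
      tsum_nonneg fun α => mul_nonneg (norm_nonneg _) (le_min zero_le_two (by
        linarith [Real.one_le_exp (mul_nonneg hε0.le (latNorm_nonneg α))]))
    calc _ ≤ (∑' α, ‖B.coeff α‖ * min 2 (Real.exp (ε * latNorm α) - 1)) *
          (‖quasiPeriodic t c‖ * (K * ‖w‖)) := by gcongr
      _ = (∑' α, ‖B.coeff α‖ * min 2 (Real.exp (ε * latNorm α) - 1)) *
          (‖quasiPeriodic t c‖ * K) * ‖w‖ := by ring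
      _ ≤ η * ‖w‖ := by gcongr
  have hws : Summable fun x => ‖w x‖ := by
    refine Summable.of_nonneg_of_le (fun _ => norm_nonneg _) (fun x => ?_)
      ((summable_exp_neg_latNorm hε0).mul_left ‖quasiPeriodic t c‖)
    rw [hw, mulOp_apply, norm_mul, norm_expWeight_apply]
    gcongr
    exact lp.norm_apply_le_norm ENNReal.top_ne_zero _ _
  have hinv : ‖((‖w‖ : ℂ))⁻¹‖ = ‖w‖⁻¹ := by rw [norm_inv, Complex.norm_real, norm_norm]
  refine ⟨((‖w‖ : ℂ))⁻¹ • w, ?_, ?_, ?_⟩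
  · rw [norm_smul, hinv, inv_mul_cancel₀ hwpos.ne']
  · refine (hws.mul_left ‖w‖⁻¹).congr fun x => ?_
    rw [lp.coeFn_smul, Pi.smul_apply, norm_smul, hinv]
  · rw [map_smul, smul_comm, ← smul_sub, norm_smul, hinv, inv_mul_le_iff₀ hwpos, mul_comm]
    exact hbound

end Periodic

/-! ### Singular sequences -/

theorem tendsto_cofinite_of_summable_norm {u : Lat N → ℂ} (hu : Summable fun x => ‖u x‖) :
    Tendsto u cofinite (𝓝 0) :=
  tendsto_zero_iff_norm_tendsto_zero.2 hu.tendsto_cofinite_zero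

/-- If `z` is an approximate eigenvalue of the limit operator `B` of `A`, then `A - z` is not
Fredholm. -/
theorem CoeffLimit.mem_essSpectrum {A B : Wiener N} {h : ℕ → Lat N} (H : CoeffLimit A h B)
    (hh : Tendsto h atTop cofinite) (p : ℝ≥0∞) [Fact (1 ≤ p)] {z : ℂ}
    (hz : ∀ η : ℝ, 0 < η →
      ∃ u : Ell N p, ‖u‖ = 1 ∧ (Summable fun x => ‖u x‖) ∧ ‖B.toOp p u - z • u‖ ≤ η) :
    z ∈ essSpectrum (A.toOp p) := by
  obtain ⟨e, he⟩ := exists_surjective_nat (Lat N)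
  have hstep : ∀ n : ℕ, ∃ u : Ell N p, ‖u‖ = 1 ∧
      (∀ m ≤ n, ‖u (e m)‖ ≤ 1 / ((n : ℝ) + 1)) ∧
      ‖(A.toOp p - z • ContinuousLinearMap.id ℂ (Ell N p)) u‖ ≤ 1 / ((n : ℝ) + 1) := by
    intro n
    have hpos : 0 < 1 / ((n : ℝ) + 1) := by positivity
    obtain ⟨u, hu1, hus, hu⟩ := hz (1 / ((n : ℝ) + 1) / 2) (half_pos hpos)
    -- A summable u tends to zero at infinity, so a far translate is small at the first n + 1 points
    -- of the enumeration; this holds for p = ∞ as well.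
    have h1 : ∀ᶠ j in atTop, ∀ m ∈ Finset.range (n + 1), ‖u (e m - h j)‖ ≤ 1 / ((n : ℝ) + 1) := by
      refine (eventually_all_finset _).2 fun m _ => ?_
      have h2 : Tendsto (fun j => e m - h j) atTop cofinite :=
        (sub_right_injective (b := e m)).tendsto_cofinite.comp hh
      have h3 := ((tendsto_cofinite_of_summable_norm hus).comp h2).norm
      rw [norm_zero] at h3
      exact h3.eventually (ge_mem_nhds hpos)
    have h4 := (H.tendsto_apply p u (hasSum_single_of_summable_norm p u hus)).sub_const (z • u)
    have h5 : ‖B.toOp p u - z • u‖ < 1 / ((n : ℝ) + 1) := hu.trans_lt (half_lt_self hpos)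
    obtain ⟨j, hj1, hj2⟩ := (h1.and (h4.norm.eventually (gt_mem_nhds h5))).exists
    refine ⟨shift p (h j) u, by rw [norm_shift_apply, hu1], fun m hm => ?_, ?_⟩
    · rw [shift_apply]
      exact hj1 m (Finset.mem_range.2 (Nat.lt_succ_of_le hm))
    -- (A - z) V_h u = V_h (V_{-h} A V_h - z) u, and V_h is isometric.
    · have h6 : (A.toOp p - z • ContinuousLinearMap.id ℂ (Ell N p)) (shift p (h j) u)
          = shift p (h j) ((A.translate (h j)).toOp p u - z • u) := by
        rw [Wiener.toOp_translate, map_sub, map_smul]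
        have h7 : ∀ v : Ell N p, shift p (h j) (shift p (-h j) v) = v := by
          intro v
          ext x
          simp
        change _ = shift p (h j) (shift p (-h j) _) - _
        rw [h7]
        rfl
      rw [h6, norm_shift_apply]
      exact hj2.le
  choose u hu1 hue hAu using hstep
  refine not_isFredholm_of_singular_sequence
    (fun x => lp.evalCLM ℂ (fun _ : Lat N => ℂ) p x) (fun v hv => lp.ext (funext hv)) u hu1
    (fun x => ?_) ?_
  · obtain ⟨m, rfl⟩ := he x
    refine squeeze_zero_norm' ?_ tendsto_one_div_add_atTop_nhds_zero_nat
    filter_upwards [eventually_ge_atTop m] with n hn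
    exact hue n m hn
  · exact squeeze_zero_norm hAu tendsto_one_div_add_atTop_nhds_zero_nat

end SemiPeriodic

end

/-! ### Assembly of the two inclusions. -/

open SemiPeriodic in
theorem proposition2p4 {N : ℕ} (hN : 0 < N) (r : Fin N → ℕ) (hr : ∀ k, 0 < r k)
    (A : Wiener N) (hA : A ∈ wienerSemiPeriodic r) :
    -- the essential spectrum is independent of the exponent in `[1, ∞]`
    (∀ (p p' : ℝ≥0∞) [Fact (1 ≤ p)] [Fact (1 ≤ p')],
      essSpectrum (A.toOp p) = essSpectrum (A.toOp p')) ∧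
    -- `op(A)` may be formed on `l^q` for any `q ∈ (1, ∞)`
    (∀ (q : ℝ≥0∞) [Fact (1 ≤ q)], 1 < q → q < ∞ →
      -- every limit operator has periodic coefficients, so that its symbol is defined
      (∀ T ∈ opSpectrum (A.toOp q), ∃ B ∈ wienerPeriodic r, B.toOp q = T) ∧
      ∀ (p : ℝ≥0∞) [Fact (1 ≤ p)],
        essSpectrum (A.toOp p) =
          ⋃ B ∈ {B : Wiener N | B.toOp q ∈ opSpectrum (A.toOp q)},
            ⋃ t : Fin N → Circle, spectrum ℂ (B.symbol r t)) := by
  have : ∀ k, NeZero (r k) := fun k => ⟨(hr k).ne'⟩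
  have key : ∀ (q : ℝ≥0∞) [Fact (1 ≤ q)], 1 < q → q < ∞ → ∀ (p : ℝ≥0∞) [Fact (1 ≤ p)],
      essSpectrum (A.toOp p) =
        ⋃ B ∈ {B : Wiener N | B.toOp q ∈ opSpectrum (A.toOp q)},
          ⋃ t : Fin N → Circle, spectrum ℂ (B.symbol r t) := by
    intro q _ hq1 hq p _
    ext z
    simp only [Set.mem_iUnion, Set.mem_ofPred_eq, exists_prop]
    constructor
    · intro hz
      obtain ⟨B, hB, t, hzt⟩ := exists_limitOp_of_not_isFredholm p A hA hz hq1 hq.ne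
      exact ⟨B, hB, t, hzt⟩
    · rintro ⟨B, ⟨h, hh, hBh⟩, t, hzt⟩
      -- B is given only through its operator; uniqueness of the coefficients transfers the
      -- convergence from B' to B.
      obtain ⟨B', hB', hBB'⟩ := exists_coeffLimit_of_isLimitOp hq.ne hBh
      have hlim : CoeffLimit A h B := fun α x => by
        rw [← Wiener.coeff_eq_of_toOp_eq hBB' α]
        exact hB' α x
      exact hlim.mem_essSpectrum hh p fun η hη =>
        exists_approximate_eigenvector p (hlim.mem_wienerPeriodic hA hh) t hzt hη
  refine ⟨fun p p' _ _ => ?_, fun q _ hq1 hq => ⟨?_, key q hq1 hq⟩⟩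
  -- With q = 2 fixed, the union on the right-hand side does not involve p.
  · have : Fact ((1 : ℝ≥0∞) ≤ 2) := ⟨one_le_two⟩
    rw [key 2 ENNReal.one_lt_two ENNReal.ofNat_lt_top p,
      key 2 ENNReal.one_lt_two ENNReal.ofNat_lt_top p']
  · rintro T ⟨h, hh, hT⟩
    obtain ⟨B, hB, hBT⟩ := exists_coeffLimit_of_isLimitOp hq.ne hT
    exact ⟨B, hB.mem_wienerPeriodic hA hh, hBT⟩
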